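/- **Conventions.** Write $\mathbb O=\mathbb H\oplus\mathbb H\mathbf e$ with multiplication $(a+b\mathbf e)(c+d\mathbf e)=(ac-\bar d b)+(da+b\bar c)\mathbf e$. Identify $\mathbb R^4\cong\mathbb H\mathbf e$ (as Euclidean spaces, by $(x_0,x_1,x_2,x_3)\mapsto(x_0+x_1\mathbf i+x_2\mathbf j+x_3\mathbf k)\mathbf e$) and the fibres of the negative spinor bundle with $\mathbb H$, so that Clifford multiplication is $\gamma(\alpha)s=\alpha s$ (octonion product), the bundle is trivial, and its total space is $S_-(\mathbb R^4)=\mathbb H\oplus\mathbb H\mathbf e=\mathbb O\cong\mathbb R^8$. The Cayley form on $\mathbb R^8$ is $\Phi(x,y,z,w)=\langle x,\tfrac12(y(\bar z w)-w(\bar z y))\rangle$; a $4$-dimensional submanifold is *Cayley* if each of its tangent spaces, suitably oriented, is calibrated by $\Phi$ (i.e. has an orthonormal basis on which $\Phi=1$). Let $L$ be a smooth oriented surface, smoothly immersed in $\mathbb R^4$ by $f$, with the induced metric. For an oriented orthonormal basis $e_1,e_2$ of a tangent plane of $L$ put $r=\gamma(e_1)\gamma(e_2)$; on $S_-|_L=L\times\mathbb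 H$ this is right multiplication by the unit imaginary quaternion $j_L=e_1e_2$, and it does not depend on the basis. Let $V_+\subset S_-|_L$ be the $+i$ eigenbundle of $r$, where the complex structure $i$ on $S_-|_L$ is *either* left multiplication by $j_L$, so that $V_+=\operatorname{span}\{1,j_L\}$, *or* left multiplication by a fixed unit imaginary quaternion $I$, so that $V_+=\{s: s\,j_L=Is\}$. (The theorem holds for each choice.) Let $V_-=V_+^\perp$. The bundle $V_-$ carries the connection $\nabla^-=\pi_{V_-}\circ\nabla$ induced by the flat connection of $S_-$, and the complex structure $J_-=-r$, which is the rotation by $\pi/2$ for the orientation of $V_-$ determined by those of $\mathbb H$ and of $V_+$ (oriented by $J_+=r$, so $J_+1=j_L$ in the first case). A smooth section $\psi$ of $V_-$ is *holomorphic* if $(\nabla^-)^{0,1}\psi=0$, that is, $\nabla^-_{e_1}\psi+J_-\nabla^-_{e_2}\psi=0$ for all oriented orthonormal $e_1,e_2$. The surface $L$ is *minimal* if $\operatorname{Tr}A^\nu=0$ for every local smooth normal field $\nu$, where $A^\nu(w)=(\nabla_w\nu)^T$. **Theorem.** Let $\psi$ be a smooth section of $V_-$ over $L$, and let $$X_\psi=\{(x,\chi+\psi_x):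 x\in L,\ \chi\in (V_+)_x\}\subset S_-(\mathbb R^4)\cong\mathbb R^8,$$ the submanifold immersed by $(x,\chi)\mapsto(f(x),\chi+\psi_x)$. Then $X_\psi$ is a Cayley submanifold of $\mathbb R^8$ if and only if $L$ is minimal in $\mathbb R^4$ and $\psi$ is a holomorphic section of $V_-$. -/

import Mathlib

open scoped Manifold ContDiff Topology Quaternion

noncomputable section

/-! ### Octonions, Clifford multiplication and the Cayley calibration -/

/-- The octonions `𝕆 = ℍ ⊕ ℍ e` as a Euclidean vector space `ℝ⁸`; the pair `(a, b)` stands for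
`a + b e`. This is also the model of the total space `S₋(ℝ⁴) ≅ ℝ⁸` of the negative spinor bundle:
the first component is the spinor in the fibre `S₋ ≅ ℍ`, the second one is the base point in
`ℝ⁴ ≅ ℍ e`. -/
abbrev Oct : Type := WithLp 2 (ℍ × ℍ)

/-- The octonion `a + b e`. -/
def octMk (a b : ℍ) : Oct := WithLp.toLp 2 (a, b)

/-- Octonion multiplication `(a + b e)(c + d e) = (a c - d̄ b) + (d a + b c̄) e`. -/
def octMul (x y : Oct) : Oct :=
  octMk (x.fst * y.fst - star y.snd * x.snd) (y.snd * x.fst + x.snd * star y.fst)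

/-- Octonion conjugation. -/
def octConj (x : Oct) : Oct := octMk (star x.fst) (-x.snd)

/-- The triple cross product `y × z × w = ½ (y (z̄ w) - w (z̄ y))` of octonions. -/
def octTripleCross (y z w : Oct) : Oct :=
  (1 / 2 : ℝ) • (octMul y (octMul (octConj z) w) - octMul w (octMul (octConj z) y))

/-- The Cayley calibration `Φ(x, y, z, w) = ⟨x, y × z × w⟩` on `ℝ⁸ = 𝕆`. -/
def cayleyForm (x y z w : Oct) : ℝ := inner ℝ x (octTripleCross y z w)

/-- A set of vectors of `ℝ⁸` is a Cayley subspace if it is a `4`-dimensional linear subspace that,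
with a suitable orientation, is calibrated by `Φ`: it has an orthonormal basis on which `Φ` is
equal to `1`. -/
def IsCayleySubspace (W : Set Oct) : Prop :=
  ∃ v : Fin 4 → Oct, Orthonormal ℝ v ∧ (Submodule.span ℝ (Set.range v) : Set Oct) = W ∧
    cayleyForm (v 0) (v 1) (v 2) (v 3) = 1

/-- The action on a negative spinor `s ∈ S₋ ≅ ℍ` of the Clifford product `γ(a) γ(b)` of two
(co)vectors `a, b ∈ ℝ⁴ ≅ ℍ e`, that is, the octonion product `(a e) ((b e) s)`, which lies
in `ℍ`. -/
def cliffordPair (a b s : ℍ) : ℍ := (octMul (octMk 0 a) (octMul (octMk 0 b) (octMk s 0))).fst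

/-- The octonion product `(a e) (b e)` of two vectors of `ℍ e`, which is an element of `ℍ`. -/
def vecMul (a b : ℍ) : ℍ := (octMul (octMk 0 a) (octMk 0 b)).fst

/-! ### Oriented immersed surfaces in `ℝ⁴` -/

variable {M : Type*} [TopologicalSpace M] [ChartedSpace (EuclideanSpace ℝ (Fin 2)) M]

/-- The differential at `x` of a map from a surface to a Euclidean space `ℍ`. -/
def dmap (g : M → ℍ) (x : M) : TangentSpace (𝓡 2) x →L[ℝ] ℍ :=
  mfderiv (𝓡 2) 𝓘(ℝ, ℍ) g x

/-- `w` is a positively oriented basis for the orientation `o` of a vector space. -/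
def IsPositiveBasis {T : Type*} [AddCommGroup T] [Module ℝ T] (o : Orientation ℝ T (Fin 2))
    (w : Fin 2 → T) : Prop :=
  ∃ b : Module.Basis (Fin 2) ℝ T, ⇑b = w ∧ b.orientation = o

variable (M) in
/-- An orientation of the surface `M`: an orientation of every tangent space, such that every point
has a neighbourhood with a continuous positively oriented frame of tangent vector fields. -/
structure SurfaceOrientation [IsManifold (𝓡 2) ∞ M] where
  /-- the orientation of the tangent space at `x` -/
  at' : ∀ x : M, Orientation ℝ (TangentSpace (𝓡 2) x) (Fin 2)
  /-- the orientation varies continuously with the point -/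
  continuous' : ∀ x₀ : M, ∃ U ∈ 𝓝 x₀, ∃ X : Fin 2 → ∀ x : M, TangentSpace (𝓡 2) x,
    (∀ i, ContinuousOn (fun x => (⟨x, X i x⟩ : TangentBundle (𝓡 2) M)) U) ∧
    ∀ x ∈ U, IsPositiveBasis (at' x) (fun i => X i x)

/-- `f` is a smooth immersion of the surface `M` in `ℝ⁴`. Here `ℝ⁴` is `ℍ` with its Euclidean
structure and the coordinates `(1, i, j, k)`, identified with `ℍ e ⊂ 𝕆` by `a ↦ a e`. -/
def IsSmoothImmersion (f : M → ℍ) : Prop :=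
  ContMDiff (𝓡 2) 𝓘(ℝ, ℍ) ∞ f ∧ ∀ x, Function.Injective (dmap f x)

/-- `w = (w₁, w₂)` is an oriented orthonormal basis of the tangent plane of the immersed surface at
`x`, with respect to the induced metric. -/
def IsOrientedFrame [IsManifold (𝓡 2) ∞ M] (f : M → ℍ) (o : SurfaceOrientation M) (x : M)
    (w : Fin 2 → TangentSpace (𝓡 2) x) : Prop :=
  Orthonormal ℝ (fun i => dmap f x (w i)) ∧ IsPositiveBasis (o.at' x) w

/-- Some oriented orthonormal basis of the tangent plane at `x`. -/
def orientedFrame [IsManifold (𝓡 2) ∞ M] (f : M → ℍ) (o : SurfaceOrientation M) (x : M) :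
    Fin 2 → TangentSpace (𝓡 2) x :=
  Classical.epsilon (IsOrientedFrame f o x)

/-- The endomorphism `r = γ(e¹) γ(e²)` of `S₋` at `x`, for an oriented orthonormal basis `e¹, e²` of
the tangent plane of the surface (it does not depend on the basis, see `spinorR_eq`). -/
def spinorR [IsManifold (𝓡 2) ∞ M] (f : M → ℍ) (o : SurfaceOrientation M) (x : M) (s : ℍ) : ℍ :=
  cliffordPair (dmap f x (orientedFrame f o x 0)) (dmap f x (orientedFrame f o x 1)) s

/-- The unit imaginary quaternion `j_L = e¹ e²`. -/
def jL [IsManifold (𝓡 2) ∞ M] (f : M → ℍ) (o : SurfaceOrientation M) (x : M) : ℍ :=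
  vecMul (dmap f x (orientedFrame f o x 0)) (dmap f x (orientedFrame f o x 1))

/-- The immersed surface is minimal: for every smooth normal vector field `ν` near a point `x`, the
trace of the second fundamental form `A^ν(w) = (∇_w ν)^T` vanishes at `x`. -/
def IsMinimalImmersion (f : M → ℍ) : Prop :=
  ∀ (x : M) (ν : M → ℍ), ContMDiffAt (𝓡 2) 𝓘(ℝ, ℍ) ∞ ν x →
    (∀ᶠ y in 𝓝 x, ∀ v : TangentSpace (𝓡 2) y, inner ℝ (ν y) (dmap f y v) = 0) →
    ∀ w : Fin 2 → TangentSpace (𝓡 2) x, Orthonormal ℝ (fun i => dmap f x (w i)) →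
      ∑ i, inner ℝ (dmap ν x (w i)) (dmap f x (w i)) = 0

/-! ### The bundles `V₊`, `V₋` and twisted bundles -/

/-- `V` is the subbundle `V₊` of `S₋(ℝ⁴)|_L = L × ℍ`, the `+i` eigenbundle of `r`. The complex
structure of `S₋` that is meant by `i` (a left multiplication on `ℍ`, which commutes with `r`) is
either the one given by `j_L` itself, in which case `V₊ = span {1, j_L}`, or a fixed one given by a
constant unit imaginary quaternion `I`. -/
def IsVPlus [IsManifold (𝓡 2) ∞ M] (f : M → ℍ) (o : SurfaceOrientation M)
    (V : M → Submodule ℝ ℍ) : Prop :=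
  (∀ x, V x = Submodule.span ℝ {1, jL f o x}) ∨
  ∃ I : ℍ, I * I = -1 ∧ ∀ x, (V x : Set ℍ) = {s | spinorR f o x s = I * s}

/-- The tangent space at the point `(x, χ + ψ x)`, `χ ∈ V x`, of the immersed submanifold
`X_ψ = V + ψ = {(x, χ + ψ x) : x ∈ L, χ ∈ V x}` of `S₋(ℝ⁴) = ℝ⁸`: the set of all velocity vectors of
curves `t ↦ (γ t, c t + ψ (γ t))` that pass through the point at `t = 0`, where `c t ∈ V (γ t)`. -/
def twistedTangent (f : M → ℍ) (V : M → Submodule ℝ ℍ) (ψ : M → ℍ) (x : M) (χ : ℍ) : Set Oct :=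
  {u | ∃ (γ : ℝ → M) (c : ℝ → ℍ), γ 0 = x ∧ c 0 = χ ∧
    MDifferentiableAt 𝓘(ℝ, ℝ) (𝓡 2) γ 0 ∧ DifferentiableAt ℝ c 0 ∧
    (∀ᶠ t in 𝓝 (0 : ℝ), c t ∈ V (γ t)) ∧
    HasDerivAt (fun t => octMk (c t + ψ (γ t)) (f (γ t))) u 0}

/-- `X_ψ = V + ψ` is a Cayley submanifold of `ℝ⁸`: all its tangent spaces are Cayley subspaces. -/
def IsCayleyTwisted (f : M → ℍ) (V : M → Submodule ℝ ℍ) (ψ : M → ℍ) : Prop :=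
  ∀ x : M, ∀ χ ∈ V x, IsCayleySubspace (twistedTangent f V ψ x χ)

/-- `ψ` is a smooth section of `V₋`, the orthogonal complement of `V = V₊`. -/
def IsSmoothSectionMinus (V : M → Submodule ℝ ℍ) (ψ : M → ℍ) : Prop :=
  ContMDiff (𝓡 2) 𝓘(ℝ, ℍ) ∞ ψ ∧ ∀ x, ψ x ∈ (V x)ᗮ

/-- The connection on `V₋` induced by the flat connection of `S₋(ℝ⁴)`: differentiate, and project
orthogonally to `V₋ = V₊ᗮ`. -/
def nablaMinus (V : M → Submodule ℝ ℍ) (ψ : M → ℍ) (x : M) (w : TangentSpace (𝓡 2) x) : ℍ :=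
  (V x)ᗮ.starProjection (dmap ψ x w)

/-- `ψ` is a holomorphic section of `V₋`: the `(0,1)`-part of its covariant derivative vanishes, that
is, `∇_{e₁} ψ + J₋ ∇_{e₂} ψ = 0` for oriented orthonormal `e₁, e₂`. The complex structure `J₋ = -r` of
`V₋` is the rotation by a right angle for the orientation of `V₋` for which `V₊ ⊕ V₋` has the
orientation of `ℍ`, where `V₊` is oriented by `J₊ = r` (`J₊ 1 = j_L` if `V₊ = span {1, j_L}`). -/
def IsHolomorphicSectionMinus [IsManifold (𝓡 2) ∞ M] (f : M → ℍ) (o : SurfaceOrientation M)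
    (V : M → Submodule ℝ ℍ) (ψ : M → ℍ) : Prop :=
  ∀ (x : M) (w : Fin 2 → TangentSpace (𝓡 2) x), IsOrientedFrame f o x w →
    nablaMinus V ψ x (w 0) + -spinorR f o x (nablaMinus V ψ x (w 1)) = 0

/-! ### `r` is well defined -/

theorem cliffordPair_eq (a b s : ℍ) : cliffordPair a b s = s * vecMul a b := by
  simp [cliffordPair, vecMul, octMul, octMk, mul_assoc]

theorem vecMul_eq (a b : ℍ) : vecMul a b = -(star b * a) := by
  simp [vecMul, octMul, octMk]

theorem spinorR_eq_mul [IsManifold (𝓡 2) ∞ M] (f : M → ℍ) (o : SurfaceOrientation M) (x : M)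
    (s : ℍ) : spinorR f o x s = s * jL f o x :=
  cliffordPair_eq _ _ _

theorem vecMul_frame_eq {T : Type*} [AddCommGroup T] [Module ℝ T] (o : Orientation ℝ T (Fin 2))
    (D : T →ₗ[ℝ] ℍ) (w w' : Fin 2 → T) (hw : Orthonormal ℝ (fun i => D (w i)))
    (hw' : Orthonormal ℝ (fun i => D (w' i))) (hp : IsPositiveBasis o w)
    (hp' : IsPositiveBasis o w') : vecMul (D (w 0)) (D (w 1)) = vecMul (D (w' 0)) (D (w' 1)) := by
  obtain ⟨b, rfl, hb⟩ := hp
  obtain ⟨b', rfl, hb'⟩ := hp'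
  have hdet : 0 < b.det b' := (b.orientation_eq_iff_det_pos b').1 (hb.trans hb'.symm)
  set p := b.repr (b' 0) 0 with hpd
  set q := b.repr (b' 0) 1 with hqd
  set r := b.repr (b' 1) 0 with hrd
  set s := b.repr (b' 1) 1 with hsd
  have h0 : b' 0 = p • b 0 + q • b 1 := by
    simpa only [Fin.sum_univ_two] using (b.sum_repr (b' 0)).symm
  have h1 : b' 1 = r • b 0 + s • b 1 := by
    simpa only [Fin.sum_univ_two] using (b.sum_repr (b' 1)).symm
  have hd : 0 < p * s - r * q := by
    have : b.det b' = p * s - r * q := by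
      rw [Module.Basis.det_apply, Matrix.det_fin_two]
      simp [Module.Basis.toMatrix_apply, hpd, hqd, hrd, hsd]
    rwa [this] at hdet
  have e00 : inner ℝ (D (b 0)) (D (b 0)) = 1 := by
    rw [real_inner_self_eq_norm_sq, hw.1 0, one_pow]
  have e11 : inner ℝ (D (b 1)) (D (b 1)) = 1 := by
    rw [real_inner_self_eq_norm_sq, hw.1 1, one_pow]
  have e01 : inner ℝ (D (b 0)) (D (b 1)) = 0 := hw.2 (by decide)
  have e10 : inner ℝ (D (b 1)) (D (b 0)) = 0 := hw.2 (by decide)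
  have f00 : inner ℝ (D (b' 0)) (D (b' 0)) = 1 := by
    rw [real_inner_self_eq_norm_sq, hw'.1 0, one_pow]
  have f11 : inner ℝ (D (b' 1)) (D (b' 1)) = 1 := by
    rw [real_inner_self_eq_norm_sq, hw'.1 1, one_pow]
  have f01 : inner ℝ (D (b' 0)) (D (b' 1)) = 0 := hw'.2 (by decide)
  simp only [h0, h1, map_add, map_smul, inner_add_left, inner_add_right, real_inner_smul_left,
    real_inner_smul_right, e00, e11, e01, e10] at f00 f11 f01
  have hr : r = -q := by
    have : (p * s - r * q) ^ 2 = 1 := by linear_combination (r^2+s^2) * f00 + f11 - (p*r+q*s)*f01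
    have h1 : p * s - r * q = 1 := by nlinarith
    have : (r + q)^2 + (s - p)^2 = 0 := by linear_combination f00 + f11 - 2 * h1
    nlinarith [sq_nonneg (r+q), sq_nonneg (s-p)]
  have hs : s = p := by
    have : (p * s - r * q) ^ 2 = 1 := by linear_combination (r^2+s^2) * f00 + f11 - (p*r+q*s)*f01
    have h1 : p * s - r * q = 1 := by nlinarith
    have : (r + q)^2 + (s - p)^2 = 0 := by linear_combination f00 + f11 - 2 * h1
    nlinarith [sq_nonneg (r+q), sq_nonneg (s-p)]
  have n0 : star (D (b 0)) * D (b 0) = 1 := by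
    rw [Quaternion.star_mul_self, Quaternion.normSq_eq_norm_mul_self]
    have := hw.1 0
    simp only at this
    simp [this]
  have n1 : star (D (b 1)) * D (b 1) = 1 := by
    rw [Quaternion.star_mul_self, Quaternion.normSq_eq_norm_mul_self]
    have := hw.1 1
    simp only at this
    simp [this]
  have n2 : star (D (b 0)) * D (b 1) = - (star (D (b 1)) * D (b 0)) := by
    have hre : inner ℝ (D (b 0)) (D (b 1)) = 0 := e01
    rw [Quaternion.inner_def] at hre
    simp only [Quaternion.re_mul, Quaternion.re_star, Quaternion.imI_star, Quaternion.imJ_star,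
      Quaternion.imK_star] at hre
    ext <;> simp only [Quaternion.re_mul, Quaternion.imI_mul, Quaternion.imJ_mul,
      Quaternion.imK_mul, Quaternion.re_star, Quaternion.imI_star, Quaternion.imJ_star,
      Quaternion.imK_star, Quaternion.re_neg, Quaternion.imI_neg, Quaternion.imJ_neg,
      Quaternion.imK_neg] <;> linarith
  rw [vecMul_eq, vecMul_eq, h0, h1, hr, hs]
  have hq : p * p + q * q = 1 := by linarith
  have key : star (D (-q • b 0 + p • b 1)) * D (p • b 0 + q • b 1) =
      (p * p + q * q) • (star (D (b 1)) * D (b 0)) := by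
    rw [map_add, map_add, map_smul, map_smul, map_smul, map_smul, star_add, Quaternion.star_smul,
      Quaternion.star_smul, add_mul, mul_add, mul_add]
    simp only [smul_mul_assoc, mul_smul_comm, n0, n1, n2]
    module
  rw [key, hq, one_smul]

/-- `r` may be computed from any oriented orthonormal basis. -/
theorem spinorR_eq [IsManifold (𝓡 2) ∞ M] (f : M → ℍ) (o : SurfaceOrientation M) (x : M)
    (w : Fin 2 → TangentSpace (𝓡 2) x) (hw : IsOrientedFrame f o x w) (s : ℍ) :
    spinorR f o x s = cliffordPair (dmap f x (w 0)) (dmap f x (w 1)) s := by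
  have h : IsOrientedFrame f o x (orientedFrame f o x) := Classical.epsilon_spec ⟨w, hw⟩
  rw [spinorR, cliffordPair_eq, cliffordPair_eq]
  exact congrArg _ (vecMul_frame_eq (o.at' x) (dmap f x).toLinearMap _ _ h.1 hw.1 h.2 hw.2)

end

set_option linter.unusedSimpArgs false

/-! ### Octonion algebra: the triple cross product and Cayley subspaces. -/

noncomputable section

/-! Both choices of $V_+$ are treated at once as a field of eigenspaces $V=\{s : s j = I s\}$, where
$j=j_L$ and $I$ is either $j_L$ or constant (`IsVPlus.exists_eigenspace`). The map $z\mapsto -Izj$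
is a self-adjoint involution, $V$ is its $+1$ eigenspace and $V^\perp$ its $-1$ eigenspace, so the
orthogonal projections are $\tfrac12(z\mp Izj)$.

Differentiating the constraint $c\,j=I\,c$ along curves in $X_\psi$ gives the tangent space at
$(x,\chi+\psi_x)$: it is $V_x$ plus the graph over $df(T_xL)$ of
$L_\chi(v)=\tfrac12(\chi\,dj(v)-dI(v)\,\chi)\,j+\nabla^-_v\psi\in V^\perp$ (`twistedTangent_eq`).
The first term of $L_\chi$ is the second fundamental form of the subbundle $V$.

For an oriented orthonormal frame $e_0,e_1$ such a $4$-plane is Cayley exactly when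
$L_\chi(e_0)=L_\chi(e_1)\,j$ (`isCayleySubspace_graph_iff`). One direction uses that Cayley planes
are closed under the triple cross product; the other exhibits a calibrated basis.

The condition is affine in $\chi$. At $\chi=0$ it is the Cauchy-Riemann equation for $\psi$; what
remains is $dj(e_0)=dj(e_1)\,j$, a Cauchy-Riemann equation for the Gauss map $j_L$
(`forall_secondFundamentalForm_iff`). Expanding $dj$ for $j=\bar e_0e_1$, and using the symmetry of
second derivatives, turns this equation into the vanishing of the normal part of
$\partial_0^2f+\partial_1^2f$ at the point (`gaussMap_eq_iff_commute`, `dmap_jL_eq_iff`), which is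
minimality (`isMinimalImmersion_iff`). -/

theorem oct_ext {x y : Oct} (h₁ : x.fst = y.fst) (h₂ : x.snd = y.snd) : x = y :=
  (WithLp.equiv 2 (ℍ × ℍ)).injective (Prod.ext h₁ h₂)

@[simp] theorem octMk_fst (a b : ℍ) : (octMk a b).fst = a := rfl
@[simp] theorem octMk_snd (a b : ℍ) : (octMk a b).snd = b := rfl

theorem quaternion_inner_eq (a b : ℍ) : inner ℝ a b =
    a.re * b.re + a.imI * b.imI + a.imJ * b.imJ + a.imK * b.imK := by
  rw [Quaternion.inner_def]
  simp

theorem oct_inner_eq (x y : Oct) :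
    inner ℝ x y = inner ℝ x.fst y.fst + inner ℝ x.snd y.snd :=
  WithLp.prod_inner_apply x y

theorem octTripleCross_fst (y z w : Oct) : (octTripleCross y z w).fst =
    (1 / 2 : ℝ) • (y.fst * (star z.fst * w.fst + star w.snd * z.snd)
      - star (w.snd * star z.fst - z.snd * star w.fst) * y.snd
      - w.fst * (star z.fst * y.fst + star y.snd * z.snd)
      + star (y.snd * star z.fst - z.snd * star y.fst) * w.snd) := by
  simp only [octTripleCross, octMul, octConj, octMk_fst, octMk_snd, WithLp.smul_fst,
    WithLp.sub_fst, mul_neg, neg_mul, sub_neg_eq_add, ← sub_eq_add_neg]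
  congr 1
  abel

theorem octTripleCross_snd (y z w : Oct) : (octTripleCross y z w).snd =
    (1 / 2 : ℝ) • ((w.snd * star z.fst - z.snd * star w.fst) * y.fst
      + y.snd * star (star z.fst * w.fst + star w.snd * z.snd)
      - (y.snd * star z.fst - z.snd * star y.fst) * w.fst
      - w.snd * star (star z.fst * y.fst + star y.snd * z.snd)) := by
  simp only [octTripleCross, octMul, octConj, octMk_fst, octMk_snd, WithLp.smul_snd,
    WithLp.sub_snd, mul_neg, neg_mul, sub_neg_eq_add, ← sub_eq_add_neg]
  congr 1
  abel

theorem octTripleCross_swap_outer (y z w : Oct) :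
    octTripleCross w z y = -octTripleCross y z w := by
  rw [octTripleCross, octTripleCross, ← smul_neg, neg_sub]

theorem octTripleCross_swap_left (y z w : Oct) :
    octTripleCross z y w = -octTripleCross y z w := by
  apply oct_ext
  · simp only [octTripleCross_fst, WithLp.neg_fst]
    ext <;> simp only [Quaternion.re_add, Quaternion.imI_add, Quaternion.imJ_add, Quaternion.imK_add,
    Quaternion.re_sub, Quaternion.imI_sub, Quaternion.imJ_sub, Quaternion.imK_sub,
    Quaternion.re_neg, Quaternion.imI_neg, Quaternion.imJ_neg, Quaternion.imK_neg,
    Quaternion.re_smul, Quaternion.imI_smul, Quaternion.imJ_smul, Quaternion.imK_smul,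
    Quaternion.re_star, Quaternion.imI_star, Quaternion.imJ_star, Quaternion.imK_star,
    Quaternion.re_mul, Quaternion.imI_mul, Quaternion.imJ_mul, Quaternion.imK_mul, smul_eq_mul] <;> ring
  · simp only [octTripleCross_snd, WithLp.neg_snd]
    ext <;> simp only [Quaternion.re_add, Quaternion.imI_add, Quaternion.imJ_add, Quaternion.imK_add,
    Quaternion.re_sub, Quaternion.imI_sub, Quaternion.imJ_sub, Quaternion.imK_sub,
    Quaternion.re_neg, Quaternion.imI_neg, Quaternion.imJ_neg, Quaternion.imK_neg,
    Quaternion.re_smul, Quaternion.imI_smul, Quaternion.imJ_smul, Quaternion.imK_smul,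
    Quaternion.re_star, Quaternion.imI_star, Quaternion.imJ_star, Quaternion.imK_star,
    Quaternion.re_mul, Quaternion.imI_mul, Quaternion.imJ_mul, Quaternion.imK_mul, smul_eq_mul] <;> ring

/-- Together with the alternation of the triple cross product this makes $\Phi$ alternating in all
four arguments. -/
theorem cayleyForm_swap_left (x y z w : Oct) : cayleyForm y x z w = -cayleyForm x y z w := by
  simp only [cayleyForm, oct_inner_eq, quaternion_inner_eq, octTripleCross_fst, octTripleCross_snd]
  simp only [Quaternion.re_add, Quaternion.imI_add, Quaternion.imJ_add, Quaternion.imK_add,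
    Quaternion.re_sub, Quaternion.imI_sub, Quaternion.imJ_sub, Quaternion.imK_sub,
    Quaternion.re_neg, Quaternion.imI_neg, Quaternion.imJ_neg, Quaternion.imK_neg,
    Quaternion.re_smul, Quaternion.imI_smul, Quaternion.imJ_smul, Quaternion.imK_smul,
    Quaternion.re_star, Quaternion.imI_star, Quaternion.imJ_star, Quaternion.imK_star,
    Quaternion.re_mul, Quaternion.imI_mul, Quaternion.imJ_mul, Quaternion.imK_mul, smul_eq_mul]
  ring

/-- Multiplicativity of the octonion norm, that is, the eight-square identity. -/
theorem octMul_inner_self (x y : Oct) :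
    inner ℝ (octMul x y) (octMul x y) = inner ℝ x x * inner ℝ y y := by
  simp only [oct_inner_eq, quaternion_inner_eq, octMul, octMk_fst, octMk_snd]
  simp only [Quaternion.re_add, Quaternion.imI_add, Quaternion.imJ_add, Quaternion.imK_add,
    Quaternion.re_sub, Quaternion.imI_sub, Quaternion.imJ_sub, Quaternion.imK_sub,
    Quaternion.re_neg, Quaternion.imI_neg, Quaternion.imJ_neg, Quaternion.imK_neg,
    Quaternion.re_smul, Quaternion.imI_smul, Quaternion.imJ_smul, Quaternion.imK_smul,
    Quaternion.re_star, Quaternion.imI_star, Quaternion.imJ_star, Quaternion.imK_star,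
    Quaternion.re_mul, Quaternion.imI_mul, Quaternion.imJ_mul, Quaternion.imK_mul, smul_eq_mul]
  ring

/-- The correction terms vanish on orthogonal triples, where the cross product is the plain product
$y(\bar z w)$ and its norm is therefore known. -/
theorem octTripleCross_eq (y z w : Oct) : octTripleCross y z w = octMul y (octMul (octConj z) w)
    - (inner ℝ y z • w + inner ℝ z w • y - inner ℝ y w • z) := by
  apply oct_ext
  · simp only [octTripleCross_fst, WithLp.sub_fst, WithLp.add_fst, WithLp.smul_fst, octMul, octConj,
      octMk_fst, octMk_snd, oct_inner_eq, quaternion_inner_eq]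
    ext <;> simp only [Quaternion.re_add, Quaternion.imI_add, Quaternion.imJ_add, Quaternion.imK_add,
    Quaternion.re_sub, Quaternion.imI_sub, Quaternion.imJ_sub, Quaternion.imK_sub,
    Quaternion.re_neg, Quaternion.imI_neg, Quaternion.imJ_neg, Quaternion.imK_neg,
    Quaternion.re_smul, Quaternion.imI_smul, Quaternion.imJ_smul, Quaternion.imK_smul,
    Quaternion.re_star, Quaternion.imI_star, Quaternion.imJ_star, Quaternion.imK_star,
    Quaternion.re_mul, Quaternion.imI_mul, Quaternion.imJ_mul, Quaternion.imK_mul, smul_eq_mul] <;> ring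
  · simp only [octTripleCross_snd, WithLp.sub_snd, WithLp.add_snd, WithLp.smul_snd, octMul, octConj,
      octMk_fst, octMk_snd, oct_inner_eq, quaternion_inner_eq]
    ext <;> simp only [Quaternion.re_add, Quaternion.imI_add, Quaternion.imJ_add, Quaternion.imK_add,
    Quaternion.re_sub, Quaternion.imI_sub, Quaternion.imJ_sub, Quaternion.imK_sub,
    Quaternion.re_neg, Quaternion.imI_neg, Quaternion.imJ_neg, Quaternion.imK_neg,
    Quaternion.re_smul, Quaternion.imI_smul, Quaternion.imJ_smul, Quaternion.imK_smul,
    Quaternion.re_star, Quaternion.imI_star, Quaternion.imJ_star, Quaternion.imK_star,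
    Quaternion.re_mul, Quaternion.imI_mul, Quaternion.imJ_mul, Quaternion.imK_mul, smul_eq_mul] <;> ring

theorem octConj_inner_self (x : Oct) : inner ℝ (octConj x) (octConj x) = inner ℝ x x := by
  rw [oct_inner_eq, oct_inner_eq]
  simp [octConj]

theorem octTripleCross_norm {y z w : Oct} (hy : ‖y‖ = 1) (hz : ‖z‖ = 1) (hw : ‖w‖ = 1)
    (hyz : inner ℝ y z = 0) (hzw : inner ℝ z w = 0) (hyw : inner ℝ y w = 0) :
    ‖octTripleCross y z w‖ = 1 := by
  have h : ‖octTripleCross y z w‖ ^ 2 = 1 := by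
    rw [octTripleCross_eq, hyz, hzw, hyw]
    simp only [zero_smul, add_zero, sub_zero]
    rw [← real_inner_self_eq_norm_sq, octMul_inner_self, octMul_inner_self, octConj_inner_self]
    simp [hy, hz, hw]
  nlinarith [norm_nonneg (octTripleCross y z w)]

theorem octMul_add (x y z : Oct) : octMul x (y + z) = octMul x y + octMul x z := by
  apply oct_ext <;> simp [octMul] <;> noncomm_ring

theorem add_octMul (x y z : Oct) : octMul (x + y) z = octMul x z + octMul y z := by
  apply oct_ext <;> simp [octMul] <;> noncomm_ring

theorem octMul_smul (r : ℝ) (x y : Oct) : octMul x (r • y) = r • octMul x y := by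
  apply oct_ext <;> simp [octMul, smul_sub]

theorem smul_octMul (r : ℝ) (x y : Oct) : octMul (r • x) y = r • octMul x y := by
  apply oct_ext <;> simp [octMul, smul_sub]

theorem octTripleCross_add_left (y y' z w : Oct) :
    octTripleCross (y + y') z w = octTripleCross y z w + octTripleCross y' z w := by
  simp only [octTripleCross, add_octMul, octMul_add]
  module

theorem octTripleCross_smul_left (r : ℝ) (y z w : Oct) :
    octTripleCross (r • y) z w = r • octTripleCross y z w := by
  simp only [octTripleCross, smul_octMul, octMul_smul]
  module

theorem octTripleCross_self_left (y w : Oct) : octTripleCross y y w = 0 := by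
  have h : (2 : ℝ) • octTripleCross y y w = 0 := by
    rw [two_smul]
    nth_rewrite 1 [octTripleCross_swap_left]
    exact neg_add_cancel _
  exact (smul_eq_zero.1 h).resolve_left two_ne_zero

theorem octTripleCross_self_outer (y z : Oct) : octTripleCross y z y = 0 := by
  rw [octTripleCross, sub_self, smul_zero]

theorem octTripleCross_swap_right (y z w : Oct) :
    octTripleCross y w z = -octTripleCross y z w := by
  rw [octTripleCross_swap_outer z w y, octTripleCross_swap_left w z y,
    octTripleCross_swap_outer y z w, neg_neg]

/-- A calibrated orthonormal quadruple is closed, up to sign, under the triple cross product. -/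
theorem octTripleCross_eq_of_cayleyForm_eq_one {v : Fin 4 → Oct} (hv : Orthonormal ℝ v)
    {a b c d : Fin 4} (hab : a ≠ b) (hac : a ≠ c) (hbc : b ≠ c)
    (h : cayleyForm (v d) (v a) (v b) (v c) = 1) : octTripleCross (v a) (v b) (v c) = v d :=
  -- Equality case of Cauchy-Schwarz: both vectors are unit vectors and their inner product is $1$.
  ((inner_eq_one_iff_of_norm_eq_one (hv.1 d) (octTripleCross_norm (hv.1 a) (hv.1 b) (hv.1 c)
    (hv.2 hab) (hv.2 hbc) (hv.2 hac))).1 h).symm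

theorem octTripleCross_mem_span_range {v : Fin 4 → Oct} (hv : Orthonormal ℝ v)
    (h : cayleyForm (v 0) (v 1) (v 2) (v 3) = 1) (a b c : Fin 4) :
    octTripleCross (v a) (v b) (v c) ∈ Submodule.span ℝ (Set.range v) := by
  have hmem : ∀ i, v i ∈ Submodule.span ℝ (Set.range v) :=
    fun i => Submodule.subset_span ⟨i, rfl⟩
  have swr : ∀ x y z w : Oct, cayleyForm x z y w = -cayleyForm x y z w := fun x y z w => by
    rw [cayleyForm, octTripleCross_swap_left, inner_neg_right, cayleyForm]
  have swo : ∀ x y z w : Oct, cayleyForm x y w z = -cayleyForm x y z w := fun x y z w => by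
    rw [cayleyForm, octTripleCross_swap_right, inner_neg_right, cayleyForm]
  -- Each order of arguments below is an even permutation of $(0,1,2,3)$, so that $\Phi$ is again
  -- $1$ and no sign appears.
  have h0 : octTripleCross (v 1) (v 2) (v 3) = v 0 :=
    octTripleCross_eq_of_cayleyForm_eq_one hv (by decide) (by decide) (by decide) h
  have h1 : octTripleCross (v 0) (v 3) (v 2) = v 1 :=
    octTripleCross_eq_of_cayleyForm_eq_one hv (by decide) (by decide) (by decide)
      (by rw [swo, cayleyForm_swap_left, neg_neg, h])
  have h2 : octTripleCross (v 0) (v 1) (v 3) = v 2 :=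
    octTripleCross_eq_of_cayleyForm_eq_one hv (by decide) (by decide) (by decide)
      (by rw [cayleyForm_swap_left, swr, neg_neg, h])
  have h3 : octTripleCross (v 0) (v 2) (v 1) = v 3 :=
    octTripleCross_eq_of_cayleyForm_eq_one hv (by decide) (by decide) (by decide)
      (by rw [cayleyForm_swap_left, swr, swo, swr, neg_neg, neg_neg, h])
  have m₀ : octTripleCross (v 1) (v 2) (v 3) ∈ Submodule.span ℝ (Set.range v) := h0 ▸ hmem 0
  have m₁ : octTripleCross (v 0) (v 2) (v 3) ∈ Submodule.span ℝ (Set.range v) := by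
    rw [octTripleCross_swap_right, h1]
    exact neg_mem (hmem 1)
  have m₂ : octTripleCross (v 0) (v 1) (v 3) ∈ Submodule.span ℝ (Set.range v) := h2 ▸ hmem 2
  have m₃ : octTripleCross (v 0) (v 1) (v 2) ∈ Submodule.span ℝ (Set.range v) := by
    rw [octTripleCross_swap_right, h3]
    exact neg_mem (hmem 3)
  have sorted : ∀ a b c : Fin 4, a < b → b < c →
      octTripleCross (v a) (v b) (v c) ∈ Submodule.span ℝ (Set.range v) := by
    intro a b c hab hbc
    obtain ⟨rfl, rfl, rfl⟩ | ⟨rfl, rfl, rfl⟩ | ⟨rfl, rfl, rfl⟩ | ⟨rfl, rfl, rfl⟩ :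
        (a = 1 ∧ b = 2 ∧ c = 3) ∨ (a = 0 ∧ b = 2 ∧ c = 3) ∨ (a = 0 ∧ b = 1 ∧ c = 3) ∨
        (a = 0 ∧ b = 1 ∧ c = 2) := by omega
    exacts [m₀, m₁, m₂, m₃]
  have swl : ∀ {y z w : Oct}, octTripleCross y z w ∈ Submodule.span ℝ (Set.range v) →
      octTripleCross z y w ∈ Submodule.span ℝ (Set.range v) := fun {y z w} hm => by
    rw [octTripleCross_swap_left]
    exact neg_mem hm
  have swr' : ∀ {y z w : Oct}, octTripleCross y z w ∈ Submodule.span ℝ (Set.range v) →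
      octTripleCross y w z ∈ Submodule.span ℝ (Set.range v) := fun {y z w} hm => by
    rw [octTripleCross_swap_right]
    exact neg_mem hm
  rcases lt_trichotomy a b with hab | rfl | hab
  · rcases lt_trichotomy b c with hbc | rfl | hbc
    · exact sorted a b c hab hbc
    · rw [octTripleCross_swap_left, octTripleCross_self_outer]
      simp
    · rcases lt_trichotomy a c with hac | rfl | hac
      · exact swr' (sorted a c b hac hbc)
      · rw [octTripleCross_self_outer]
        exact zero_mem _
      · exact swr' (swl (sorted c a b hac hab))
  · rw [octTripleCross_self_left]
    exact zero_mem _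
  · rcases lt_trichotomy a c with hac | rfl | hac
    · exact swl (sorted b a c hab hac)
    · rw [octTripleCross_self_outer]
      exact zero_mem _
    · rcases lt_trichotomy b c with hbc | rfl | hbc
      · exact swl (swr' (sorted b c a hbc hac))
      · rw [octTripleCross_swap_left, octTripleCross_self_outer]
        simp
      · exact swl (swr' (swl (sorted c b a hbc hab)))

/-- A Cayley subspace is closed under the triple cross product. -/
theorem IsCayleySubspace.octTripleCross_mem {W : Set Oct} (hW : IsCayleySubspace W) {y z w : Oct}
    (hy : y ∈ W) (hz : z ∈ W) (hw : w ∈ W) : octTripleCross y z w ∈ W := by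
  obtain ⟨v, hv, rfl, h⟩ := hW
  simp only [SetLike.mem_coe] at *
  -- Linearity is needed in the first slot only; alternation brings each of the other slots there in
  -- turn.
  have step : ∀ p q : Oct, (∀ a, octTripleCross (v a) p q ∈ Submodule.span ℝ (Set.range v)) →
      ∀ x ∈ Submodule.span ℝ (Set.range v),
        octTripleCross x p q ∈ Submodule.span ℝ (Set.range v) := by
    intro p q hpq x hx
    induction hx using Submodule.span_induction with
    | mem x hx => obtain ⟨a, rfl⟩ := hx; exact hpq a
    | zero =>
      have := octTripleCross_smul_left 0 0 p q
      rw [zero_smul, zero_smul] at this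
      rw [this]
      exact zero_mem _
    | add x y _ _ hx hy => rw [octTripleCross_add_left]; exact add_mem hx hy
    | smul r x _ hx => rw [octTripleCross_smul_left]; exact Submodule.smul_mem _ r hx
  refine step z w (fun a => ?_) y hy
  rw [octTripleCross_swap_left]
  refine neg_mem (step (v a) w (fun b => ?_) z hz)
  rw [octTripleCross_swap_outer]
  refine neg_mem (step (v a) (v b) (fun c => ?_) w hw)
  exact octTripleCross_mem_span_range hv h c a b

/-! ### The eigenspaces `{s | s j = I s}` -/

section Eigenspace

variable {I j : ℍ}

theorem Quaternion.re_eq_zero_of_mul_self (hI : I * I = -1) : I.re = 0 := by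
  have h0 := congrArg QuaternionAlgebra.re hI
  have h1 := congrArg QuaternionAlgebra.imI hI
  have h2 := congrArg QuaternionAlgebra.imJ hI
  have h3 := congrArg QuaternionAlgebra.imK hI
  simp only [Quaternion.re_mul, Quaternion.imI_mul, Quaternion.imJ_mul, Quaternion.imK_mul,
    Quaternion.re_neg, Quaternion.imI_neg, Quaternion.imJ_neg, Quaternion.imK_neg,
    Quaternion.re_one, Quaternion.imI_one, Quaternion.imJ_one, Quaternion.imK_one] at h0 h1 h2 h3
  by_contra hre
  have e1 : I.imI = 0 := (mul_eq_zero.1 (by linarith : I.re * I.imI = 0)).resolve_left hre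
  have e2 : I.imJ = 0 := (mul_eq_zero.1 (by linarith : I.re * I.imJ = 0)).resolve_left hre
  have e3 : I.imK = 0 := (mul_eq_zero.1 (by linarith : I.re * I.imK = 0)).resolve_left hre
  rw [e1, e2, e3] at h0
  nlinarith [sq_nonneg I.re]

theorem Quaternion.star_eq_neg_of_mul_self (hI : I * I = -1) : star I = -I := by
  have h := Quaternion.re_eq_zero_of_mul_self hI
  ext <;> simp [h]

theorem inner_mul_left_eq (q a b : ℍ) : inner ℝ (q * a) b = inner ℝ a (star q * b) := by
  simp only [quaternion_inner_eq]
  simp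
  ring

theorem inner_mul_right_eq (q a b : ℍ) : inner ℝ (a * q) b = inner ℝ a (b * star q) := by
  simp only [quaternion_inner_eq]
  simp
  ring

theorem star_mul_add_star_mul (a b : ℍ) :
    star a * b + star b * a = ((2 * inner ℝ a b : ℝ) : ℍ) := by
  rw [quaternion_inner_eq]
  ext <;> simp <;> ring

theorem star_mul_eq_neg_of_inner_eq_zero {a b : ℍ} (h : inner ℝ a b = 0) :
    star a * b = -(star b * a) := by
  rw [eq_neg_iff_add_eq_zero, star_mul_add_star_mul, h]
  simp

theorem star_mul_self_of_norm_eq_one {a : ℍ} (h : ‖a‖ = 1) : star a * a = 1 := by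
  rw [Quaternion.star_mul_self, Quaternion.normSq_eq_norm_mul_self, h]
  simp

theorem self_mul_star_of_norm_eq_one {a : ℍ} (h : ‖a‖ = 1) : a * star a = 1 := by
  rw [Quaternion.self_mul_star, Quaternion.normSq_eq_norm_mul_self, h]
  simp

theorem norm_eq_one_of_mul_self_eq_neg_one (hI : I * I = -1) : ‖I‖ = 1 := by
  have h : ‖I‖ * ‖I‖ = 1 := by rw [← norm_mul, hI, norm_neg, norm_one]
  nlinarith [norm_nonneg I]

theorem mul_self_mul (hI : I * I = -1) (x : ℍ) : I * (I * x) = -x := by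
  rw [← mul_assoc, hI, neg_one_mul]

/-- The quaternions commuting with a unit imaginary quaternion `j` are `ℝ + ℝ j`. -/
theorem commute_iff_exists (hj : j * j = -1) (q : ℍ) :
    q * j = j * q ↔ ∃ a b : ℝ, q = a • 1 + b • j := by
  constructor
  · intro h
    have hre := Quaternion.re_eq_zero_of_mul_self hj
    have n := congrArg QuaternionAlgebra.re hj
    have h1 := congrArg QuaternionAlgebra.imI h
    have h2 := congrArg QuaternionAlgebra.imJ h
    have h3 := congrArg QuaternionAlgebra.imK h
    simp only [Quaternion.re_mul, Quaternion.imI_mul, Quaternion.imJ_mul, Quaternion.imK_mul,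
      Quaternion.re_neg, Quaternion.re_one, hre] at n h1 h2 h3
    -- Commuting with $j$ means that the imaginary part of $q$ has zero cross product with $j$, so
    -- it equals its projection on the unit vector $j$.
    refine ⟨q.re, q.imI * j.imI + q.imJ * j.imJ + q.imK * j.imK, ?_⟩
    ext
    · simp [hre]
    · simp
      linear_combination q.imI * n + j.imJ / 2 * h3 - j.imK / 2 * h2
    · simp
      linear_combination q.imJ * n + j.imK / 2 * h1 - j.imI / 2 * h3
    · simp
      linear_combination q.imK * n + j.imI / 2 * h2 - j.imJ / 2 * h1
  · rintro ⟨a, b, rfl⟩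
    simp [add_mul, mul_add]

variable {V : Submodule ℝ ℍ}

/-- Since $I^2=j^2=-1$, the map $z\mapsto -Izj$ is an involution that fixes exactly $V$; this is
twice the projection onto its fixed space. -/
theorem proj_mem_eigenspace (hI : I * I = -1) (hj : j * j = -1) (hV : ∀ s, s ∈ V ↔ s * j = I * s)
    (z : ℍ) : z - I * z * j ∈ V := by
  rw [hV, sub_mul, mul_sub, mul_assoc (I * z), hj, mul_assoc I z j, mul_self_mul hI,
    mul_neg_one]
  abel

theorem proj_mem_orthogonal_eigenspace (hI : I * I = -1) (hj : j * j = -1)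
    (hV : ∀ s, s ∈ V ↔ s * j = I * s) (z : ℍ) : z + I * z * j ∈ Vᗮ := by
  rw [Submodule.mem_orthogonal]
  intro s hs
  have h := (hV s).1 hs
  have : inner ℝ s (I * z * j) = -inner ℝ s z := by
    rw [real_inner_comm, inner_mul_right_eq, inner_mul_left_eq,
      Quaternion.star_eq_neg_of_mul_self hI, Quaternion.star_eq_neg_of_mul_self hj,
      mul_neg, h, neg_mul_neg, mul_self_mul hI, inner_neg_right, real_inner_comm]
  rw [inner_add_right, this, add_neg_cancel]

theorem mem_orthogonal_eigenspace_iff (hI : I * I = -1) (hj : j * j = -1)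
    (hV : ∀ s, s ∈ V ↔ s * j = I * s) (z : ℍ) : z ∈ Vᗮ ↔ z * j = -(I * z) := by
  constructor
  · intro hz
    have h1 : (2 : ℝ) • z = (z + I * z * j) + (z - I * z * j) := by rw [two_smul]; abel
    have h2 : z - I * z * j ∈ Vᗮ := by
      have : z - I * z * j = (2 : ℝ) • z - (z + I * z * j) := by rw [h1]; abel
      rw [this]
      exact sub_mem (Submodule.smul_mem _ _ hz) (proj_mem_orthogonal_eigenspace hI hj hV z)
    have h3 : z - I * z * j = 0 :=
      inner_self_eq_zero.1 ((Submodule.mem_orthogonal _ _).1 h2 _ (proj_mem_eigenspace hI hj hV z))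
    have h4 : z = I * z * j := sub_eq_zero.1 h3
    nth_rewrite 1 [h4]
    rw [mul_assoc, hj, mul_neg_one]
  · intro hz
    have : z = (1 / 2 : ℝ) • (z + I * z * j) := by
      rw [mul_assoc, hz, mul_neg, mul_self_mul hI, neg_neg]
      module
    rw [this]
    exact Submodule.smul_mem _ _ (proj_mem_orthogonal_eigenspace hI hj hV z)

theorem starProjection_orthogonal_eigenspace (hI : I * I = -1) (hj : j * j = -1)
    (hV : ∀ s, s ∈ V ↔ s * j = I * s) (z : ℍ) :
    Vᗮ.starProjection z = (1 / 2 : ℝ) • (z + I * z * j) := by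
  refine Submodule.eq_starProjection_of_mem_orthogonal
    (Submodule.smul_mem _ _ (proj_mem_orthogonal_eigenspace hI hj hV z)) ?_
  have : z - (1 / 2 : ℝ) • (z + I * z * j) = (1 / 2 : ℝ) • (z - I * z * j) := by module
  rw [this]
  exact Submodule.le_orthogonal_orthogonal _
    (Submodule.smul_mem _ _ (proj_mem_eigenspace hI hj hV z))

/-- If $V$ were zero, then $t=Itj$ for every $t$. At $t=1$ this gives $j=-I$, so $I$ is central,
hence real, against $I^2=-1$. -/
theorem exists_mem_eigenspace_norm_eq_one (hI : I * I = -1) (hj : j * j = -1)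
    (hV : ∀ s, s ∈ V ↔ s * j = I * s) : ∃ s ∈ V, ‖s‖ = 1 := by
  have : ∃ s ∈ V, s ≠ 0 := by
    by_contra! h
    have key : ∀ t : ℍ, t = I * t * j := fun t =>
      sub_eq_zero.1 (h _ (proj_mem_eigenspace hI hj hV t))
    have hj' : j = -I := by
      have := congrArg (I * ·) (key 1)
      simp only [mul_one] at this
      rw [mul_self_mul hI] at this
      rw [this, neg_neg]
    have hcomm : ∀ t : ℍ, t * I = I * t := fun t => by
      have := congrArg (· * I) (key t)
      simp only [hj', mul_assoc, neg_mul, hI, mul_neg, neg_neg, mul_one] at this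
      exact this
    have hre := Quaternion.re_eq_zero_of_mul_self hI
    have n := congrArg QuaternionAlgebra.re hI
    obtain ⟨p, p0, p1, p2, p3⟩ : ∃ p : ℍ, p.re = 0 ∧ p.imI = 1 ∧ p.imJ = 0 ∧ p.imK = 0 :=
      ⟨⟨0, 1, 0, 0⟩, rfl, rfl, rfl, rfl⟩
    obtain ⟨q, q0, q1, q2, q3⟩ : ∃ q : ℍ, q.re = 0 ∧ q.imI = 0 ∧ q.imJ = 1 ∧ q.imK = 0 :=
      ⟨⟨0, 0, 1, 0⟩, rfl, rfl, rfl, rfl⟩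
    have a2 := congrArg QuaternionAlgebra.imJ (hcomm p)
    have a3 := congrArg QuaternionAlgebra.imK (hcomm p)
    have b3 := congrArg QuaternionAlgebra.imK (hcomm q)
    simp only [Quaternion.re_mul, Quaternion.imJ_mul, Quaternion.imK_mul, p0, p1, p2, p3,
      q0, q1, q2, q3, Quaternion.re_neg, Quaternion.re_one, hre] at n a2 a3 b3
    have e1 : I.imI = 0 := by linarith
    have e2 : I.imJ = 0 := by linarith
    have e3 : I.imK = 0 := by linarith
    rw [e1, e2, e3] at n
    norm_num at n
  obtain ⟨s, hs, hs0⟩ := this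
  refine ⟨(‖s‖⁻¹ : ℝ) • s, Submodule.smul_mem _ _ hs, norm_smul_inv_norm hs0⟩

theorem mul_mem_eigenspace (hV : ∀ s, s ∈ V ↔ s * j = I * s) {s : ℍ} (hs : s ∈ V) :
    s * j ∈ V := by
  rw [hV, (hV s).1 hs, mul_assoc, (hV s).1 hs]

/-- $V$ is the plane $s(\mathbb R+\mathbb Rj)$: for $s,z\in V$ the quaternion $\bar s z$ commutes
with $j$. -/
theorem exists_eq_smul_add_smul_of_mem_eigenspace (hI : I * I = -1) (hj : j * j = -1)
    (hV : ∀ s, s ∈ V ↔ s * j = I * s) {s z : ℍ} (hs : s ∈ V) (hs1 : ‖s‖ = 1) (hz : z ∈ V) :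
    ∃ a b : ℝ, z = a • s + b • (s * j) := by
  have h1 := (hV s).1 hs
  have h2 := congrArg star h1
  rw [star_mul, star_mul, Quaternion.star_eq_neg_of_mul_self hI,
    Quaternion.star_eq_neg_of_mul_self hj, neg_mul, mul_neg, neg_inj] at h2
  obtain ⟨a, b, hab⟩ := (commute_iff_exists hj (star s * z)).1 (by
    rw [mul_assoc, (hV z).1 hz, ← mul_assoc, ← h2, mul_assoc])
  refine ⟨a, b, ?_⟩
  have := congrArg (s * ·) hab
  simp only [← mul_assoc, self_mul_star_of_norm_eq_one hs1, one_mul, mul_add, mul_smul_comm,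
    mul_one] at this
  exact this

/-- The plane `V ⊕ {(L t, E t)}` in `ℝ⁸`, where `V` is an eigenspace, `E₀, E₁` is an orthonormal
pair with `E₀⁻¹ E₁ = j` and `L₀, L₁` are orthogonal to `V`, is Cayley if and only if
`L₀ = L₁ j`. -/
theorem isCayleySubspace_graph_iff (hI : I * I = -1) (hj : j * j = -1)
    (hV : ∀ s, s ∈ V ↔ s * j = I * s) {E₀ E₁ L₀ L₁ : ℍ} (h0 : ‖E₀‖ = 1) (h1 : ‖E₁‖ = 1)
    (hE : star E₀ * E₁ = j) (hL₀ : L₀ ∈ Vᗮ) (hL₁ : L₁ ∈ Vᗮ) :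
    IsCayleySubspace {u | ∃ s ∈ V, ∃ a b : ℝ,
      u = octMk (s + (a • L₀ + b • L₁)) (a • E₀ + b • E₁)} ↔ L₀ = L₁ * j := by
  obtain ⟨s, hs, hs1⟩ := exists_mem_eigenspace_norm_eq_one hI hj hV
  have hsj := (hV s).1 hs
  have jstar := Quaternion.star_eq_neg_of_mul_self hj
  have Istar := Quaternion.star_eq_neg_of_mul_self hI
  have hE' : star E₁ * E₀ = -j := by
    have := congrArg star hE
    rwa [star_mul, star_star, jstar] at this
  have l0 := (mem_orthogonal_eigenspace_iff hI hj hV L₀).1 hL₀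
  have l1 := (mem_orthogonal_eigenspace_iff hI hj hV L₁).1 hL₁
  constructor
  · intro hW
    -- The cross product of a vector of $V$ with the two graph vectors must stay in the plane; only
    -- its $\mathbb H\mathbf e$ component is used, which has to lie in the span of $E_0,E_1$.
    have hmem := hW.octTripleCross_mem (y := octMk s 0) (z := octMk L₀ E₀) (w := octMk L₁ E₁)
      ⟨s, hs, 0, 0, by simp⟩ ⟨0, zero_mem _, 1, 0, by simp⟩ ⟨0, zero_mem _, 0, 1, by simp⟩
    obtain ⟨_, -, a, b, hab⟩ := hmem
    have hsnd := congrArg (fun u : Oct => star E₀ * u.snd) hab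
    have f0 : star s * L₀ = -(star L₀ * s) :=
      star_mul_eq_neg_of_inner_eq_zero ((Submodule.mem_orthogonal _ _).1 hL₀ s hs)
    have f1 : star s * L₁ = -(star L₁ * s) :=
      star_mul_eq_neg_of_inner_eq_zero ((Submodule.mem_orthogonal _ _).1 hL₁ s hs)
    have e0 := star_mul_self_of_norm_eq_one h0
    have hcross : (octTripleCross (octMk s 0) (octMk L₀ E₀) (octMk L₁ E₁)).snd =
        E₁ * (star L₀ * s) - E₀ * (star L₁ * s) := by
      rw [octTripleCross_snd]
      simp only [octMk_fst, octMk_snd, zero_mul, zero_sub, star_zero, mul_zero, add_zero, neg_mul,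
        mul_assoc, sub_mul, star_mul, star_star, f0, f1, mul_neg]
      module
    simp only [hcross, octMk_snd] at hsnd
    -- This is $\bar E_0$ times that component. It lies in $\mathbb R+\mathbb Rj$ and so commutes
    -- with $j$, while $s\in V$ and $L_i\in V^\perp$ make it anticommute with $j$; hence it
    -- vanishes.
    set q := j * (star L₀ * s) - star L₁ * s with hq
    have hqab : q = a • 1 + b • j := by
      simp only [mul_sub, mul_add, ← mul_assoc, hE, e0, one_mul, mul_smul_comm] at hsnd
      rw [hq, ← hsnd, mul_assoc]
    have hcomm : q * j = j * q := (commute_iff_exists hj q).2 ⟨a, b, hqab⟩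
    have g0 : star L₀ * I = -(j * star L₀) := by
      have := congrArg star l0
      rw [star_mul, star_neg, star_mul, Istar, jstar] at this
      rw [neg_mul, mul_neg, neg_neg] at this
      exact this.symm
    have g1 : star L₁ * I = -(j * star L₁) := by
      have := congrArg star l1
      rw [star_mul, star_neg, star_mul, Istar, jstar] at this
      rw [neg_mul, mul_neg, neg_neg] at this
      exact this.symm
    have hanti : q * j = -(j * q) := by
      rw [hq, sub_mul, mul_assoc, mul_assoc, mul_assoc, hsj, ← mul_assoc (star L₀), g0,
        ← mul_assoc (star L₁), g1, mul_sub]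
      noncomm_ring
    have hq0 : q = 0 := by
      have h2 : (2 : ℝ) • (j * q) = 0 := by
        rw [two_smul]
        nth_rewrite 1 [← hcomm, hanti]
        exact neg_add_cancel _
      have h3 := (smul_eq_zero.1 h2).resolve_left two_ne_zero
      have := mul_self_mul hj q
      rw [h3, mul_zero] at this
      exact neg_eq_zero.1 this.symm
    have hss' := self_mul_star_of_norm_eq_one hs1
    have h4 : j * star L₀ = star L₁ := by
      have := congrArg (· * star s) hq0
      simp only [hq, sub_mul, mul_assoc, hss', mul_one, zero_mul] at this
      exact sub_eq_zero.1 this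
    have h5 := congrArg star h4
    rw [star_mul, star_star, star_star, jstar] at h5
    rw [← h5, mul_assoc, neg_mul, hj, neg_neg, mul_one]
  · intro hL
    have hE01 : inner ℝ E₀ E₁ = 0 := by
      have hc := star_mul_add_star_mul E₀ E₁
      rw [hE, hE', add_neg_cancel] at hc
      have := congrArg QuaternionAlgebra.re hc
      simp at this
      linarith
    have hinner_j : ∀ z : ℍ, inner ℝ z (z * j) = 0 := fun z => by
      have := inner_mul_right_eq j z z
      rw [jstar, mul_neg, inner_neg_right, real_inner_comm] at this
      linarith
    have hjn := norm_eq_one_of_mul_self_eq_neg_one hj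
    set n : ℝ := ‖L₁‖ ^ 2 with hn
    have hn0 : 0 < 1 + n := by positivity
    -- Both graph vectors have squared length $1+n$, because $L_0=L_1j$ gives $\|L_0\|=\|L_1\|$; $k$
    -- normalizes them.
    set k : ℝ := (Real.sqrt (1 + n))⁻¹ with hk
    have hk2 : k * k * (1 + n) = 1 := by
      rw [hk, ← mul_inv, Real.mul_self_sqrt hn0.le, inv_mul_cancel₀ hn0.ne']
    have hk0 : k ≠ 0 := by
      intro h
      rw [h] at hk2
      simp at hk2
    have sL : ∀ z ∈ V, ∀ L ∈ Vᗮ, inner ℝ z L = 0 := fun z hz L hL =>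
      (Submodule.mem_orthogonal _ _).1 hL z hz
    have hsjm := mul_mem_eigenspace hV hs
    refine ⟨![octMk s 0, octMk (s * j) 0, k • octMk L₀ E₀, k • octMk L₁ E₁], ?_, ?_, ?_⟩
    · have i00 : inner ℝ s s = 1 := by rw [real_inner_self_eq_norm_sq, hs1, one_pow]
      have n0 : ‖L₀‖ ^ 2 = n := by rw [hL, norm_mul, hjn, mul_one]
      rw [orthonormal_iff_ite]
      have aux : ∀ u u' : Oct, ∀ r : ℝ, inner ℝ u u' = r → inner ℝ u' u = r := fun u u' r h => by
        rw [real_inner_comm, h]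
      have c01 : inner ℝ (octMk s 0) (octMk (s * j) 0) = 0 := by
        simp [oct_inner_eq, hinner_j]
      have c02 : inner ℝ (octMk s 0) (k • octMk L₀ E₀) = 0 := by
        simp [oct_inner_eq, inner_smul_right, sL s hs L₀ hL₀]
      have c03 : inner ℝ (octMk s 0) (k • octMk L₁ E₁) = 0 := by
        simp [oct_inner_eq, inner_smul_right, sL s hs L₁ hL₁]
      have c12 : inner ℝ (octMk (s * j) 0) (k • octMk L₀ E₀) = 0 := by
        simp [oct_inner_eq, inner_smul_right, sL _ hsjm L₀ hL₀]
      have c13 : inner ℝ (octMk (s * j) 0) (k • octMk L₁ E₁) = 0 := by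
        simp [oct_inner_eq, inner_smul_right, sL _ hsjm L₁ hL₁]
      have c23 : inner ℝ (k • octMk L₀ E₀) (k • octMk L₁ E₁) = 0 := by
        simp only [oct_inner_eq, WithLp.smul_fst, WithLp.smul_snd, octMk_fst, octMk_snd,
          real_inner_smul_left, inner_smul_right, hE01]
        rw [hL, real_inner_comm, hinner_j]
        simp
      have c00 : inner ℝ (octMk s 0) (octMk s 0) = 1 := by
        simp only [oct_inner_eq, octMk_fst, octMk_snd, i00, inner_zero_left, add_zero]
      have c11 : inner ℝ (octMk (s * j) 0) (octMk (s * j) 0) = 1 := by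
        simp only [oct_inner_eq, octMk_fst, octMk_snd, inner_zero_left, add_zero]
        simp only [real_inner_self_eq_norm_sq, norm_mul, hs1, hjn, one_mul, one_pow]
      have c22 : inner ℝ (k • octMk L₀ E₀) (k • octMk L₀ E₀) = 1 := by
        simp only [oct_inner_eq, WithLp.smul_fst, WithLp.smul_snd, octMk_fst, octMk_snd,
          real_inner_smul_left, inner_smul_right]
        simp only [real_inner_self_eq_norm_sq, n0, h0]
        linarith
      have c33 : inner ℝ (k • octMk L₁ E₁) (k • octMk L₁ E₁) = 1 := by
        simp only [oct_inner_eq, WithLp.smul_fst, WithLp.smul_snd, octMk_fst, octMk_snd,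
          real_inner_smul_left, inner_smul_right]
        simp only [real_inner_self_eq_norm_sq, ← hn, h1]
        linarith
      intro a b
      fin_cases a <;> fin_cases b
      exacts [c00, c01, c02, c03, aux _ _ _ c01, c11, c12, c13, aux _ _ _ c02, aux _ _ _ c12, c22,
        c23, aux _ _ _ c03, aux _ _ _ c13, aux _ _ _ c23, c33]
    · ext u
      simp only [Matrix.range_cons, Matrix.range_empty, Set.union_empty, SetLike.mem_coe,
        Set.singleton_union, Submodule.mem_span_insert, Submodule.mem_span_singleton,
        Set.mem_ofPred_eq]
      constructor
      · rintro ⟨a, _, ⟨b, _, ⟨c, _, ⟨d, rfl⟩, rfl⟩, rfl⟩, rfl⟩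
        refine ⟨a • s + b • (s * j), add_mem (V.smul_mem _ hs) (V.smul_mem _ hsjm), c * k, d * k, ?_⟩
        apply oct_ext
        · simp only [WithLp.add_fst, WithLp.smul_fst, octMk_fst]
          module
        · simp only [WithLp.add_snd, WithLp.smul_snd, octMk_snd]
          module
      · rintro ⟨z, hz, c, d, rfl⟩
        obtain ⟨a, b, rfl⟩ := exists_eq_smul_add_smul_of_mem_eigenspace hI hj hV hs hs1 hz
        refine ⟨a, _, ⟨b, _, ⟨c * k⁻¹, _, ⟨d * k⁻¹, rfl⟩, rfl⟩, rfl⟩, ?_⟩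
        apply oct_ext
        · simp only [WithLp.add_fst, WithLp.smul_fst, octMk_fst, smul_smul, mul_assoc,
            inv_mul_cancel₀ hk0, mul_one]
          module
        · simp only [WithLp.add_snd, WithLp.smul_snd, octMk_snd, smul_smul, mul_assoc,
            inv_mul_cancel₀ hk0, mul_one, smul_zero, zero_add]
    · have t1 : star L₁ * L₁ = n • (1 : ℍ) := by
        rw [Quaternion.star_mul_self, Quaternion.normSq_eq_norm_mul_self, hn, sq,
          ← Quaternion.coe_mul_eq_smul, mul_one]
      have t2 : L₁ * star L₁ = n • (1 : ℍ) := by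
        rw [Quaternion.self_mul_star, Quaternion.normSq_eq_norm_mul_self, hn, sq,
          ← Quaternion.coe_mul_eq_smul, mul_one]
      have t3 : star L₀ * L₁ = -(n • j) := by
        rw [hL, star_mul, mul_assoc, t1, jstar, mul_smul_comm, mul_one, smul_neg]
      have t4 : L₁ * star L₀ = n • I := by
        rw [hL, star_mul, jstar, neg_mul, mul_neg, ← mul_assoc, l1, neg_mul, mul_assoc, t2,
          mul_smul_comm, mul_one, neg_neg]
      -- The first basis vector $(s,0)$ has no $\mathbb H\mathbf e$ component, so the value of
      -- $\Phi$ only sees this component of the cross product.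
      have hcross : (octTripleCross (octMk (s * j) 0) (k • octMk L₀ E₀) (k • octMk L₁ E₁)).fst
          = s := by
        rw [octTripleCross_fst]
        simp only [octMk_fst, octMk_snd, WithLp.smul_fst, WithLp.smul_snd, star_zero, zero_mul,
          mul_zero, zero_sub, sub_zero, add_zero, star_neg, star_mul, star_star,
          Quaternion.star_smul, smul_mul_assoc, mul_smul_comm, neg_mul, smul_zero]
        have e1 : s * j * j = -s := by rw [mul_assoc, hj, mul_neg_one]
        rw [t3, hE', mul_assoc (s * j) (star E₀) E₁, hE, ← mul_assoc L₁, t4, hsj, smul_mul_assoc,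
          mul_self_mul hI, ← hsj]
        simp only [mul_add, mul_neg, mul_smul_comm, e1]
        trans (k * k * (1 + n)) • s
        · module
        · rw [hk2, one_smul]
      simp only [cayleyForm, Matrix.cons_val_zero, Matrix.cons_val_one, Matrix.cons_val]
      rw [oct_inner_eq, hcross]
      simp [hs1]

end Eigenspace

theorem ne_zero_of_mul_self_eq_neg_one {j : ℍ} (hj : j * j = -1) : j ≠ 0 := by
  rintro rfl
  simp at hj

theorem commute_of_mul_right {j : ℍ} (hj : j * j = -1) {q : ℍ} (h : q * j * j = j * (q * j)) :
    q * j = j * q := by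
  rw [← mul_assoc] at h
  exact mul_right_cancel₀ (ne_zero_of_mul_self_eq_neg_one hj) h

theorem commute_mul_right {j q : ℍ} (h : q * j = j * q) : q * j * j = j * (q * j) := by
  rw [h, mul_assoc, h]

theorem eq_zero_of_commute_of_anticommute {j : ℍ} (hj : j * j = -1) {q : ℍ} (h : q * j = j * q)
    (h' : q * j = -(j * q)) : q = 0 := by
  have h2 : (2 : ℝ) • (q * j) = 0 := by
    rw [two_smul]
    nth_rewrite 2 [h']
    rw [h, add_neg_cancel]
  exact (mul_eq_zero.1 ((smul_eq_zero.1 h2).resolve_left two_ne_zero)).resolve_right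
    (ne_zero_of_mul_self_eq_neg_one hj)

/-- If `d₀, d₁` are the derivatives of the Gauss map `j = ē₀ e₁` and `hᵢₖ = ē₀ ∂ᵢ eₖ`, then
`d₀ = d₁ j` says that the normal part of `h₀₀ + h₁₁` vanishes. -/
theorem gaussMap_eq_iff_commute {j d₀ d₁ h₀₀ h₀₁ h₁₁ c₀ c₁ : ℍ} (hj : j * j = -1)
    (a₀ : d₀ * j = -(j * d₀)) (a₁ : d₁ * j = -(j * d₁)) (e₀ : d₀ = star h₀₀ * j + h₀₁ + c₀)
    (e₁ : d₁ = star h₀₁ * j + h₁₁ + c₁) (hc₀ : c₀ * j = j * c₀) (hc₁ : c₁ * j = j * c₁) :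
    d₀ = d₁ * j ↔ (h₀₀ + h₁₁) * j = j * (h₀₀ + h₁₁) := by
  have s₀ : star h₀₀ = ((2 * h₀₀.re : ℝ) : ℍ) - h₀₀ := by
    rw [eq_sub_iff_add_eq, add_comm, Quaternion.self_add_star]
    push_cast
    rfl
  have s₁ : star h₀₁ = ((2 * h₀₁.re : ℝ) : ℍ) - h₀₁ := by
    rw [eq_sub_iff_add_eq, add_comm, Quaternion.self_add_star]
    push_cast
    rfl
  set r₀ := ((2 * h₀₀.re : ℝ) : ℍ) with hr₀
  set r₁ := ((2 * h₀₁.re : ℝ) : ℍ) with hr₁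
  have k₀ : r₀ * j = j * r₀ := Quaternion.coe_commutes _ _
  have k₁ : r₁ * j = j * r₁ := Quaternion.coe_commutes _ _
  set C := r₀ * j + c₀ + r₁ - c₁ * j with hC
  have hCj : C * j = j * C := by
    simp only [hC, add_mul, sub_mul, mul_add, mul_sub, k₁, hc₀]
    rw [commute_mul_right k₀, commute_mul_right hc₁]
  -- The mixed term $h_{01}$ cancels, as it is the same quaternion in both derivatives; everything
  -- left besides $h_{00}+h_{11}$ commutes with $j$.
  have key : d₀ - d₁ * j = C - (h₀₀ + h₁₁) * j := by
    rw [e₀, e₁, s₀, s₁, hC]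
    simp only [add_mul, sub_mul, mul_assoc, hj]
    noncomm_ring
  constructor
  · intro h
    rw [h, sub_self, eq_comm, sub_eq_zero] at key
    exact commute_of_mul_right hj (by rw [← key, hCj])
  · intro h
    rw [← sub_eq_zero]
    -- The difference $d_0-d_1j$ always anticommutes with $j$, so it is enough that it also
    -- commutes.
    apply eq_zero_of_commute_of_anticommute hj
    · rw [key, sub_mul, mul_sub, hCj, commute_mul_right h]
    · rw [sub_mul, mul_sub, a₀, a₁, neg_mul, mul_neg, ← mul_assoc j j d₁, hj]
      simp only [mul_assoc, neg_mul, one_mul, mul_neg, neg_neg, a₁]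
      rw [mul_self_mul hj]
      abel

/-- The centralizer $\mathbb R+\mathbb Rj$ of $j$ is $\bar E_0$ times the span of $E_0,E_1$, so
commutation says that $H$ is tangent to that plane. -/
theorem commute_iff_forall_normal {j E₀ E₁ : ℍ} (hj : j * j = -1) (h0 : ‖E₀‖ = 1) (h1 : ‖E₁‖ = 1)
    (hE : star E₀ * E₁ = j) (h01 : inner ℝ E₀ E₁ = 0) (H : ℍ) :
    (star E₀ * H) * j = j * (star E₀ * H) ↔
      ∀ ν : ℍ, inner ℝ ν E₀ = 0 → inner ℝ ν E₁ = 0 → inner ℝ ν H = 0 := by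
  have hs := self_mul_star_of_norm_eq_one h0
  rw [commute_iff_exists hj]
  constructor
  · rintro ⟨a, b, h⟩ ν ν0 ν1
    have : H = a • E₀ + b • E₁ := by
      have := congrArg (E₀ * ·) h
      simp only [← hE, ← mul_assoc, hs, mul_add, mul_smul_comm, one_mul, mul_one] at this
      exact this
    rw [this, inner_add_right, inner_smul_right, inner_smul_right, ν0, ν1]
    simp
  · intro h
    have i00 : inner ℝ E₀ E₀ = 1 := by rw [real_inner_self_eq_norm_sq, h0, one_pow]
    have i11 : inner ℝ E₁ E₁ = 1 := by rw [real_inner_self_eq_norm_sq, h1, one_pow]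
    have i10 : inner ℝ E₁ E₀ = 0 := by rw [real_inner_comm, h01]
    -- The normal part of $H$, tested against $H$ itself, has norm zero.
    set ν := H - inner ℝ H E₀ • E₀ - inner ℝ H E₁ • E₁ with hν
    have n0 : inner ℝ ν E₀ = 0 := by
      simp only [hν, inner_sub_left, real_inner_smul_left, i00, i10]
      ring
    have n1 : inner ℝ ν E₁ = 0 := by
      simp only [hν, inner_sub_left, real_inner_smul_left, i11, h01]
      ring
    have nn : inner ℝ ν ν = 0 := by
      nth_rewrite 2 [hν]
      rw [inner_sub_right, inner_sub_right, inner_smul_right, inner_smul_right, n0, n1, h ν n0 n1]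
      ring
    have hz : ν = 0 := inner_self_eq_zero.1 nn
    have hH : H = inner ℝ H E₀ • E₀ + inner ℝ H E₁ • E₁ := by
      rw [hν, sub_sub, sub_eq_zero] at hz
      exact hz
    refine ⟨inner ℝ H E₀, inner ℝ H E₁, ?_⟩
    nth_rewrite 1 [hH]
    rw [mul_add, mul_smul_comm, mul_smul_comm, hE, star_mul_self_of_norm_eq_one h0]

/-- The pointwise form of the Cauchy-Riemann type condition for `X_ψ`, where the second fundamental
form of the eigenspace `V` is expressed by the derivatives of `j` and `I`. -/
theorem forall_secondFundamentalForm_iff {I j : ℍ} (hI : I * I = -1) (hj : j * j = -1)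
    {V : Submodule ℝ ℍ} (hV : ∀ s, s ∈ V ↔ s * j = I * s) {d₀ d₁ D₀ D₁ p₀ p₁ : ℍ}
    (a₀ : d₀ * j = -(j * d₀)) (a₁ : d₁ * j = -(j * d₁))
    (hD : (I = j ∧ D₀ = d₀ ∧ D₁ = d₁) ∨ (D₀ = 0 ∧ D₁ = 0)) :
    (∀ χ ∈ V, (1 / 2 : ℝ) • ((χ * d₀ - D₀ * χ) * j) + p₀ =
      ((1 / 2 : ℝ) • ((χ * d₁ - D₁ * χ) * j) + p₁) * j) ↔ d₀ = d₁ * j ∧ p₀ = p₁ * j := by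
  rcases hD with ⟨rfl, rfl, rfl⟩ | ⟨rfl, rfl⟩
  · have fI : ∀ d : ℍ, d * I = -(I * d) → (I * d - d * I) * I = (2 : ℝ) • d := fun d hd => by
      rw [sub_mul, mul_assoc, hd, mul_neg, mul_self_mul hj, neg_mul, mul_assoc, hd, mul_neg,
        mul_self_mul hj]
      module
    have fχ : ∀ d : ℍ, d * I = -(I * d) → ∀ a b : ℝ, (1 / 2 : ℝ) • (((a • 1 + b • I) * d
        - d * (a • 1 + b • I)) * I) = b • d := fun d hd a b => by
      have : (a • 1 + b • I) * d - d * (a • 1 + b • I) = b • (I * d - d * I) := by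
        simp only [add_mul, mul_add, smul_mul_assoc, mul_smul_comm, one_mul, mul_one]
        module
      rw [this, smul_mul_assoc, fI d hd]
      module
    constructor
    · intro h
      -- $\chi=0$ isolates the equation for $\psi$. For $\chi=a+bI$ the second fundamental form is
      -- $b\,d$, so $\chi=I$ gives the equation for the Gauss map.
      have h0 : p₀ = p₁ * I := by simpa using h 0 (zero_mem _)
      have h1 := h I ((hV I).2 rfl)
      have f₀ := fχ D₀ a₀ 0 1
      have f₁ := fχ D₁ a₁ 0 1
      simp only [zero_smul, one_smul, zero_add] at f₀ f₁
      rw [f₀, f₁, h0, add_mul] at h1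
      exact ⟨add_right_cancel h1, h0⟩
    · rintro ⟨h1, h2⟩ χ hχ
      obtain ⟨a, b, rfl⟩ := (commute_iff_exists hj χ).1 ((hV χ).1 hχ)
      rw [fχ D₀ a₀, fχ D₁ a₁, add_mul, smul_mul_assoc, ← h1, ← h2]
  · constructor
    · intro h
      have h0 := h 0 (zero_mem _)
      simp only [zero_mul, sub_zero, smul_zero, zero_add] at h h0
      refine ⟨?_, h0⟩
      obtain ⟨s, hs, hs1⟩ := exists_mem_eigenspace_norm_eq_one hI hj hV
      -- With $I$ constant the second fundamental form is $\tfrac12\chi\,d\,j$, and any nonzero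
      -- $\chi\in V$ can be cancelled on the left.
      have h1 := h s hs
      rw [h0, add_mul, add_left_inj, smul_mul_assoc] at h1
      have h2 := smul_right_injective ℍ (by norm_num : (1 / 2 : ℝ) ≠ 0) h1
      have h3 := mul_right_cancel₀ (ne_zero_of_mul_self_eq_neg_one hj) h2
      have hs0 : s ≠ 0 := by
        rintro rfl
        simp at hs1
      exact mul_left_cancel₀ hs0 (by rw [h3, mul_assoc])
    · rintro ⟨h1, h2⟩ χ -
      rw [h1, h2]
      simp only [zero_mul, sub_zero, add_mul, smul_mul_assoc, mul_assoc]

/-! ### Positive bases of an oriented plane and Gram-Schmidt. -/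

section OrientedBases

variable {T : Type*} [AddCommGroup T] [Module ℝ T] {o : Orientation ℝ T (Fin 2)}

theorem isPositiveBasis_iff_det_pos (b : Module.Basis (Fin 2) ℝ T) (hb : b.orientation = o)
    (w : Fin 2 → T) : IsPositiveBasis o w ↔ 0 < b.det w := by
  constructor
  · rintro ⟨b', rfl, hb'⟩
    exact (b.orientation_eq_iff_det_pos b').1 (hb.trans hb'.symm)
  · intro h
    obtain ⟨hl, hs⟩ := (Module.Basis.is_basis_iff_det b).2 (isUnit_iff_ne_zero.2 h.ne')
    refine ⟨Module.Basis.mk hl hs.ge, Module.Basis.coe_mk _ _, ?_⟩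
    rw [← hb, eq_comm, Module.Basis.orientation_eq_iff_det_pos, Module.Basis.coe_mk]
    exact h

theorem basis_det_fin_two (b : Module.Basis (Fin 2) ℝ T) (w : Fin 2 → T) :
    b.det w = b.repr (w 0) 0 * b.repr (w 1) 1 - b.repr (w 1) 0 * b.repr (w 0) 1 := by
  rw [Module.Basis.det_apply, Matrix.det_fin_two]
  simp [Module.Basis.toMatrix_apply]

/-- The signed area of the parallelogram spanned by two vectors of the plane. -/
def signedArea (u v : EuclideanSpace ℝ (Fin 2)) : ℝ := u 0 * v 1 - u 1 * v 0

theorem signedArea_map (b : Module.Basis (Fin 2) ℝ T) (A : T →ₗ[ℝ] EuclideanSpace ℝ (Fin 2))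
    (w : Fin 2 → T) :
    signedArea (A (w 0)) (A (w 1)) = b.det w * signedArea (A (b 0)) (A (b 1)) := by
  have h : ∀ i, A (w i) = b.repr (w i) 0 • A (b 0) + b.repr (w i) 1 • A (b 1) := fun i => by
    rw [← map_smul A, ← map_smul A, ← map_add A]
    congr 1
    simpa only [Fin.sum_univ_two] using (b.sum_repr (w i)).symm
  rw [basis_det_fin_two, h 0, h 1]
  simp [signedArea]
  ring

theorem signedArea_basis_ne_zero (b : Module.Basis (Fin 2) ℝ T)
    (A : T →ₗ[ℝ] EuclideanSpace ℝ (Fin 2)) (hA : Function.Injective A) :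
    signedArea (A (b 0)) (A (b 1)) ≠ 0 := by
  intro h
  have hl : ∀ p q : ℝ, p • A (b 0) + q • A (b 1) = 0 → p = 0 ∧ q = 0 := by
    intro p q hpq
    rw [← map_smul A, ← map_smul A, ← map_add A] at hpq
    have := Fintype.linearIndependent_iff.1 b.linearIndependent ![p, q]
      (by simpa [Fin.sum_univ_two] using hA (hpq.trans (map_zero A).symm))
    exact ⟨this 0, this 1⟩
  have h1 := hl (A (b 1) 1) (-(A (b 0) 1)) (by
    ext i
    fin_cases i
    · simp
      rw [signedArea] at h
      linarith
    · simp
      ring)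
  have h2 := hl (A (b 1) 0) (-(A (b 0) 0)) (by
    ext i
    fin_cases i
    · simp
      ring
    · simp
      rw [signedArea] at h
      linarith)
  have h3 : A (b 0) = 0 := by
    ext i
    fin_cases i
    · simpa using h2.2
    · simpa using h1.2
  exact b.ne_zero 0 (hA (h3.trans (map_zero A).symm))

/-- Replaces orientation by the sign of a continuous expression, so that positivity can be
propagated to nearby points. -/
theorem isPositiveBasis_iff_signedArea {X : Fin 2 → T} (hX : IsPositiveBasis o X)
    (A : T →ₗ[ℝ] EuclideanSpace ℝ (Fin 2)) (hA : Function.Injective A) (w : Fin 2 → T) :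
    IsPositiveBasis o w ↔
      0 < signedArea (A (w 0)) (A (w 1)) * signedArea (A (X 0)) (A (X 1)) := by
  obtain ⟨b, rfl, hb⟩ := hX
  have h := signedArea_basis_ne_zero b A hA
  rw [isPositiveBasis_iff_det_pos b hb, signedArea_map b A w, mul_assoc]
  exact (mul_pos_iff_of_pos_right (mul_self_pos.2 h)).symm

theorem vecMul_eq_of_inner_eq_zero {a b : ℍ} (h : inner ℝ a b = 0) : vecMul a b = star a * b := by
  rw [vecMul_eq, star_mul_eq_neg_of_inner_eq_zero h]

theorem vecMul_mul_self {a b : ℍ} (ha : ‖a‖ = 1) (hb : ‖b‖ = 1) (h : inner ℝ a b = 0) :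
    vecMul a b * vecMul a b = -1 := by
  nth_rewrite 2 [vecMul_eq]
  rw [vecMul_eq_of_inner_eq_zero h, mul_neg, mul_assoc, ← mul_assoc b,
    self_mul_star_of_norm_eq_one hb, one_mul, star_mul_self_of_norm_eq_one ha]

/-- The Gram-Schmidt process: an oriented orthonormal basis from a positive one. -/
theorem exists_orthonormal_positiveBasis (D : T →ₗ[ℝ] ℍ) (hD : Function.Injective D)
    {X : Fin 2 → T} (hX : IsPositiveBasis o X) :
    ∃ w : Fin 2 → T, Orthonormal ℝ (fun i => D (w i)) ∧ IsPositiveBasis o w ∧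
      vecMul (D (w 0)) (D (w 1)) = ‖star (D (X 0)) * D (X 1) - star (D (X 1)) * D (X 0)‖⁻¹ •
        (star (D (X 0)) * D (X 1) - star (D (X 1)) * D (X 0)) := by
  obtain ⟨b, rfl, hb⟩ := hX
  have hl : LinearIndependent ℝ ![b 0, b 1] := by
    convert b.linearIndependent using 1
    ext i : 1
    fin_cases i <;> rfl
  rw [LinearIndependent.pair_iff] at hl
  set g := D (b 0) with hg
  have hg0 : g ≠ 0 := fun h => b.ne_zero 0 (hD (h.trans (map_zero D).symm))
  have hgn : 0 < ‖g‖ := norm_pos_iff.2 hg0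
  set r : ℝ := inner ℝ g (D (b 1)) / ‖g‖ ^ 2 with hr
  set v := D (b 1) - r • g with hv
  have hv0 : v ≠ 0 := by
    intro h
    have h' : D (-r • b 0 + (1 : ℝ) • b 1) = 0 := by
      rw [map_add, map_smul, map_smul, ← hg, ← h, hv]
      module
    have := hl _ _ (hD (h'.trans (map_zero D).symm))
    exact one_ne_zero this.2
  have hvn : 0 < ‖v‖ := norm_pos_iff.2 hv0
  have hgv : inner ℝ g v = 0 := by
    rw [hv, inner_sub_right, inner_smul_right, real_inner_self_eq_norm_sq, hr]
    field_simp
    ring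
  have hw0 : D (‖g‖⁻¹ • b 0) = ‖g‖⁻¹ • g := by rw [map_smul]
  have hw1 : D (‖v‖⁻¹ • (b 1 - r • b 0)) = ‖v‖⁻¹ • v := by
    rw [map_smul, map_sub, map_smul]
  have n0 : ‖‖g‖⁻¹ • g‖ = 1 := norm_smul_inv_norm hg0
  have n1 : ‖‖v‖⁻¹ • v‖ = 1 := norm_smul_inv_norm hv0
  have n01 : inner ℝ (‖g‖⁻¹ • g) (‖v‖⁻¹ • v) = 0 := by
    rw [inner_smul_right, real_inner_smul_left, hgv]
    simp
  refine ⟨![‖g‖⁻¹ • b 0, ‖v‖⁻¹ • (b 1 - r • b 0)], ?_, ?_, ?_⟩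
  · refine ⟨fun i => ?_, fun i k hik => ?_⟩
    · fin_cases i
      · exact (congrArg norm hw0).trans n0
      · exact (congrArg norm hw1).trans n1
    · fin_cases i <;> fin_cases k
      · exact absurd rfl hik
      · simp only [Fin.zero_eta, Fin.mk_one, Matrix.cons_val_zero, Matrix.cons_val_one]
        rw [hw0, hw1, n01]
      · simp only [Fin.zero_eta, Fin.mk_one, Matrix.cons_val_zero, Matrix.cons_val_one]
        rw [hw0, hw1, real_inner_comm, n01]
      · exact absurd rfl hik
  · rw [isPositiveBasis_iff_det_pos b hb, basis_det_fin_two]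
    simp
    positivity
  · simp only [Matrix.cons_val_zero, Matrix.cons_val_one]
    rw [hw0, hw1]
    -- The expression $\bar ab-\bar ba$ is alternating in $(a,b)$, so subtracting a multiple of $g$
    -- does not change it and Gram-Schmidt only rescales it by a positive factor. The factor is then
    -- fixed by the norm being $1$.
    have e : vecMul (‖g‖⁻¹ • g) (‖v‖⁻¹ • v) = (‖g‖⁻¹ * ‖v‖⁻¹ / 2) •
        (star g * D (b 1) - star (D (b 1)) * g) := by
      have h2 : vecMul (‖g‖⁻¹ • g) (‖v‖⁻¹ • v) = (1 / 2 : ℝ) •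
          (star (‖g‖⁻¹ • g) * (‖v‖⁻¹ • v) - star (‖v‖⁻¹ • v) * (‖g‖⁻¹ • g)) := by
        rw [vecMul_eq_of_inner_eq_zero n01, star_mul_eq_neg_of_inner_eq_zero
          (a := ‖v‖⁻¹ • v) (by rw [real_inner_comm, n01])]
        module
      rw [h2, hv]
      simp only [Quaternion.star_smul, star_sub, smul_mul_assoc, mul_smul_comm, mul_sub, sub_mul]
      module
    have hk : 0 < ‖g‖⁻¹ * ‖v‖⁻¹ / 2 := by positivity
    have hn : ‖vecMul (‖g‖⁻¹ • g) (‖v‖⁻¹ • v)‖ = 1 :=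
      norm_eq_one_of_mul_self_eq_neg_one (vecMul_mul_self n0 n1 n01)
    rw [e] at hn ⊢
    rw [norm_smul, Real.norm_of_nonneg hk.le] at hn
    rw [eq_inv_of_mul_eq_one_left hn]

/-- Minimality speaks of all orthonormal frames, holomorphicity and $j_L$ only of oriented ones;
swapping the two vectors bridges the gap. -/
theorem isPositiveBasis_or_swap (D : T →ₗ[ℝ] ℍ) {X : Fin 2 → T} (hX : IsPositiveBasis o X)
    {w : Fin 2 → T} (hw : Orthonormal ℝ (fun i => D (w i))) :
    IsPositiveBasis o w ∨ IsPositiveBasis o ![w 1, w 0] := by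
  obtain ⟨b, rfl, hb⟩ := hX
  have hl : LinearIndependent ℝ w := LinearIndependent.of_comp D hw.linearIndependent
  have hc : Fintype.card (Fin 2) = Module.finrank ℝ T := (Module.finrank_eq_card_basis b).symm
  have hu := b.isUnit_det (basisOfLinearIndependentOfCardEqFinrank hl hc)
  rw [coe_basisOfLinearIndependentOfCardEqFinrank] at hu
  have hs : b.det ![w 1, w 0] = -b.det w := by
    rw [basis_det_fin_two, basis_det_fin_two]
    simp
  rw [isPositiveBasis_iff_det_pos b hb, isPositiveBasis_iff_det_pos b hb, hs]
  rcases lt_or_gt_of_ne hu.ne_zero with h | h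
  · exact Or.inr (neg_pos.2 h)
  · exact Or.inl h

end OrientedBases

/-! ### Oriented frames on the surface. -/

section Frames

variable {M : Type*} [TopologicalSpace M] [ChartedSpace (EuclideanSpace ℝ (Fin 2)) M]
  [IsManifold (𝓡 2) ∞ M] {f : M → ℍ} {o : SurfaceOrientation M} {x : M}

theorem jL_eq (w : Fin 2 → TangentSpace (𝓡 2) x) (hw : IsOrientedFrame f o x w) :
    jL f o x = vecMul (dmap f x (w 0)) (dmap f x (w 1)) := by
  have h : IsOrientedFrame f o x (orientedFrame f o x) := Classical.epsilon_spec ⟨w, hw⟩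
  exact vecMul_frame_eq (o.at' x) (dmap f x).toLinearMap _ _ h.1 hw.1 h.2 hw.2

theorem SurfaceOrientation.exists_positiveBasis (o : SurfaceOrientation M) (x : M) :
    ∃ X : Fin 2 → TangentSpace (𝓡 2) x, IsPositiveBasis (o.at' x) X := by
  obtain ⟨U, hU, X, -, hX⟩ := o.continuous' x
  exact ⟨_, hX x (mem_of_mem_nhds hU)⟩

theorem exists_isOrientedFrame (o : SurfaceOrientation M) (hf : Function.Injective (dmap f x)) :
    ∃ w, IsOrientedFrame f o x w := by
  obtain ⟨X, hX⟩ := o.exists_positiveBasis x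
  obtain ⟨w, h1, h2, -⟩ := exists_orthonormal_positiveBasis (dmap f x).toLinearMap hf hX
  exact ⟨w, h1, h2⟩

/-- Expresses $j_L$ through any positive frame, with no orthonormality and no chosen basis, so that
it can be differentiated. -/
theorem jL_eq_of_positiveBasis (hf : Function.Injective (dmap f x))
    {X : Fin 2 → TangentSpace (𝓡 2) x} (hX : IsPositiveBasis (o.at' x) X) :
    jL f o x = ‖star (dmap f x (X 0)) * dmap f x (X 1)
        - star (dmap f x (X 1)) * dmap f x (X 0)‖⁻¹ •
      (star (dmap f x (X 0)) * dmap f x (X 1) - star (dmap f x (X 1)) * dmap f x (X 0)) := by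
  obtain ⟨w, h1, h2, h3⟩ := exists_orthonormal_positiveBasis (dmap f x).toLinearMap hf hX
  exact (jL_eq w ⟨h1, h2⟩).trans h3

theorem jL_mul_self (hf : Function.Injective (dmap f x)) : jL f o x * jL f o x = -1 := by
  obtain ⟨w, hw⟩ := exists_isOrientedFrame o hf
  rw [jL_eq w hw]
  exact vecMul_mul_self (hw.1.1 0) (hw.1.1 1) (hw.1.2 (by decide))

variable (x) in
/-- The differential at `y` of the chart at `x`. -/
def chartDeriv (y : M) : TangentSpace (𝓡 2) y →L[ℝ] EuclideanSpace ℝ (Fin 2) :=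
  mfderiv (𝓡 2) 𝓘(ℝ, EuclideanSpace ℝ (Fin 2)) (extChartAt (𝓡 2) x) y

/-- A tangent frame that is constant in a chart and positive at one point is positive nearby. -/
theorem eventually_isPositiveBasis (o : SurfaceOrientation M) (x : M)
    (a : Fin 2 → EuclideanSpace ℝ (Fin 2)) {X : Fin 2 → ∀ y : M, TangentSpace (𝓡 2) y}
    (hXa : ∀ y ∈ (chartAt (EuclideanSpace ℝ (Fin 2)) x).source, ∀ i,
      chartDeriv x y (X i y) = a i)
    (hX : IsPositiveBasis (o.at' x) (fun i => X i x)) :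
    ∀ᶠ y in 𝓝 x, IsPositiveBasis (o.at' y) (fun i => X i y) := by
  obtain ⟨U, hU, Z, hZ, hZp⟩ := o.continuous' x
  have hinj : ∀ y ∈ (chartAt (EuclideanSpace ℝ (Fin 2)) x).source, Function.Injective (chartDeriv x y) := by
    intro y hy
    exact (isInvertible_mfderiv_extChartAt (by rwa [extChartAt_source])).injective
  -- Continuity of the orienting frame as a map into the tangent bundle is read in the
  -- trivialization at $x$, whose fibre maps are the derivatives of the chart.
  have hcont : ∀ i, ContinuousAt (fun y => chartDeriv x y (Z i y)) x := by
    intro i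
    have h1 := ((FiberBundle.continuousAt_totalSpace _ _).1 ((hZ i).continuousAt hU)).2
    refine h1.congr ?_
    filter_upwards [chart_source_mem_nhds (EuclideanSpace ℝ (Fin 2)) x] with y hy
    rw [chartDeriv, ← TangentBundle.continuousLinearMapAt_trivializationAt hy]
    exact (Bundle.Trivialization.continuousLinearMapAt_apply_of_mem _ _ (by simpa using hy) _).symm
  have hcoord : ∀ i k, ContinuousAt (fun y => chartDeriv x y (Z i y) k) x :=
    fun i k => (EuclideanSpace.proj (𝕜 := ℝ) k).continuous.continuousAt.comp (hcont i)
  -- Product of the constant signed area of the given frame and the varying one of the orienting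
  -- frame; its positivity at $x$ persists nearby.
  have harea : ContinuousAt (fun y => signedArea (a 0) (a 1) *
      signedArea (chartDeriv x y (Z 0 y)) (chartDeriv x y (Z 1 y))) x :=
    continuousAt_const.mul (((hcoord 0 0).mul (hcoord 1 1)).sub ((hcoord 0 1).mul (hcoord 1 0)))
  have hxs := mem_chart_source (EuclideanSpace ℝ (Fin 2)) x
  have hpos := (isPositiveBasis_iff_signedArea (hZp x (mem_of_mem_nhds hU)) (chartDeriv x x).toLinearMap
    (hinj x hxs) _).1 hX
  have hpos' : 0 < signedArea (a 0) (a 1) * signedArea (chartDeriv x x (Z 0 x)) (chartDeriv x x (Z 1 x)) := by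
    rw [← hXa x hxs 0, ← hXa x hxs 1]
    exact hpos
  filter_upwards [harea.eventually (lt_mem_nhds hpos'), hU,
    chart_source_mem_nhds (EuclideanSpace ℝ (Fin 2)) x] with y hy hyU hys
  refine (isPositiveBasis_iff_signedArea (hZp y hyU) (chartDeriv x y).toLinearMap (hinj y hys) _).2 ?_
  rw [← hXa y hys 0, ← hXa y hys 1] at hy
  exact hy

end Frames

/-! ### Maps on the surface read in a chart. -/

section Chart

variable {M : Type*} [TopologicalSpace M] [ChartedSpace (EuclideanSpace ℝ (Fin 2)) M] {x : M}

theorem eventuallyEq_comp_chart_symm (g : M → ℍ) {y : M}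
    (hy : y ∈ (chartAt (EuclideanSpace ℝ (Fin 2)) x).source) :
    g =ᶠ[𝓝 y] (g ∘ (extChartAt (𝓡 2) x).symm) ∘ extChartAt (𝓡 2) x := by
  filter_upwards [(chartAt (EuclideanSpace ℝ (Fin 2)) x).open_source.mem_nhds hy] with z hz
  simp only [Function.comp_apply]
  rw [(extChartAt (𝓡 2) x).left_inv (by rwa [extChartAt_source])]

theorem eventually_comp_chart (x : M) (p : EuclideanSpace ℝ (Fin 2) → Prop)
    (hp : ∀ᶠ q in 𝓝 (extChartAt (𝓡 2) x x), p q) : ∀ᶠ y in 𝓝 x, p (extChartAt (𝓡 2) x y) :=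
  (continuousAt_extChartAt x).eventually hp

theorem eventually_chart_symm (x : M) (p : M → Prop) (hp : ∀ᶠ y in 𝓝 x, p y) :
    ∀ᶠ q in 𝓝 (extChartAt (𝓡 2) x x), p ((extChartAt (𝓡 2) x).symm q) := by
  have h := continuousAt_extChartAt_symm (I := 𝓡 2) x
  rw [ContinuousAt, extChartAt_to_inv] at h
  exact h.eventually hp

theorem eventually_mem_chart_target (x : M) :
    ∀ᶠ q in 𝓝 (extChartAt (𝓡 2) x x), q ∈ (extChartAt (𝓡 2) x).target :=
  extChartAt_target_mem_nhds x

theorem ContMDiffAt.contDiffAt_comp_chart_symm {g : M → ℍ} {n : ℕ∞ω}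
    (hg : ContMDiffAt (𝓡 2) 𝓘(ℝ, ℍ) n g x) :
    ContDiffAt ℝ n (g ∘ (extChartAt (𝓡 2) x).symm) (extChartAt (𝓡 2) x x) := by
  have h := (contMDiffAt_iff_source (I := 𝓡 2)).1 hg
  rw [contMDiffWithinAt_iff_contDiffWithinAt] at h
  rw [ModelWithCorners.range_eq_univ, contDiffWithinAt_univ] at h
  exact h

variable [IsManifold (𝓡 2) ∞ M]

instance : IsManifold (𝓡 2) 1 M := IsManifold.of_le (n := ∞) (by simp)

theorem hasMFDerivAt_chart {y : M} (hy : y ∈ (chartAt (EuclideanSpace ℝ (Fin 2)) x).source) :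
    HasMFDerivAt (𝓡 2) 𝓘(ℝ, EuclideanSpace ℝ (Fin 2)) (extChartAt (𝓡 2) x) y (chartDeriv x y) :=
  (mdifferentiableAt_extChartAt hy).hasMFDerivAt

theorem chartDeriv_surjective {y : M}
    (hy : y ∈ (chartAt (EuclideanSpace ℝ (Fin 2)) x).source) :
    Function.Surjective (chartDeriv x y) :=
  (isInvertible_mfderiv_extChartAt (by rwa [extChartAt_source])).surjective

theorem HasMFDerivAt.of_comp_chart {g : M → ℍ} {G : EuclideanSpace ℝ (Fin 2) → ℍ} {y : M}
    (hy : y ∈ (chartAt (EuclideanSpace ℝ (Fin 2)) x).source)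
    (hgG : g =ᶠ[𝓝 y] G ∘ extChartAt (𝓡 2) x)
    (hG : DifferentiableAt ℝ G (extChartAt (𝓡 2) x y)) :
    HasMFDerivAt (𝓡 2) 𝓘(ℝ, ℍ) g y
      ((fderiv ℝ G (extChartAt (𝓡 2) x y)).comp (chartDeriv x y)) :=
  (hG.hasFDerivAt.hasMFDerivAt.comp y (hasMFDerivAt_chart hy)).congr_of_eventuallyEq hgG

theorem dmap_of_comp_chart {g : M → ℍ} {G : EuclideanSpace ℝ (Fin 2) → ℍ} {y : M}
    (hy : y ∈ (chartAt (EuclideanSpace ℝ (Fin 2)) x).source)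
    (hgG : g =ᶠ[𝓝 y] G ∘ extChartAt (𝓡 2) x)
    (hG : DifferentiableAt ℝ G (extChartAt (𝓡 2) x y)) (v : TangentSpace (𝓡 2) y) :
    dmap g y v = fderiv ℝ G (extChartAt (𝓡 2) x y) (chartDeriv x y v) := by
  rw [dmap, (HasMFDerivAt.of_comp_chart hy hgG hG).mfderiv]
  rfl

end Chart

/-! ### The derivative of the Gauss map. -/

section GaussMap

instance : StarModule ℝ ℍ := ⟨fun r a => by simp⟩

variable {G₀ G₁ : EuclideanSpace ℝ (Fin 2) → ℍ} {p : EuclideanSpace ℝ (Fin 2)}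

theorem inv_norm_smul_mul_self {q : ℍ} (hq : star q = -q) (h0 : q ≠ 0) :
    (‖q‖⁻¹ • q) * (‖q‖⁻¹ • q) = -1 := by
  have h : q * q = -((‖q‖ * ‖q‖ : ℝ) : ℍ) := by
    rw [← Quaternion.normSq_eq_norm_mul_self, ← Quaternion.self_mul_star, hq, mul_neg, neg_neg]
  rw [smul_mul_smul_comm, h, smul_neg, ← Quaternion.coe_mul_eq_smul, ← Quaternion.coe_mul]
  have hn : ‖q‖ ≠ 0 := norm_ne_zero_iff.2 h0
  rw [show ‖q‖⁻¹ * ‖q‖⁻¹ * (‖q‖ * ‖q‖) = 1 by field_simp, Quaternion.coe_one]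

/-- The unit imaginary quaternion determined by an oriented pair of independent vectors. -/
def unitCross (a b : ℍ) : ℍ := ‖star a * b - star b * a‖⁻¹ • (star a * b - star b * a)

/-- The derivative of the Gauss map `unitCross G₀ G₁` at a point where `G₀, G₁` are orthonormal. -/
theorem exists_fderiv_unitCross (h0 : ‖G₀ p‖ = 1) (h1 : ‖G₁ p‖ = 1)
    (h01 : inner ℝ (G₀ p) (G₁ p) = 0) (hG₀ : DifferentiableAt ℝ G₀ p)
    (hG₁ : DifferentiableAt ℝ G₁ p) :
    DifferentiableAt ℝ (fun q => unitCross (G₀ q) (G₁ q)) p ∧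
    ∀ a, ∃ c : ℍ, c * (star (G₀ p) * G₁ p) = star (G₀ p) * G₁ p * c ∧
      fderiv ℝ (fun q => unitCross (G₀ q) (G₁ q)) p a =
        star (star (G₀ p) * fderiv ℝ G₀ p a) * (star (G₀ p) * G₁ p)
          + star (G₀ p) * fderiv ℝ G₁ p a + c := by
  set n : EuclideanSpace ℝ (Fin 2) → ℍ := fun q => star (G₀ q) * G₁ q - star (G₁ q) * G₀ q with hn
  set j := star (G₀ p) * G₁ p with hj
  have hnp : n p = (2 : ℝ) • j := by
    rw [hn, two_smul, hj]
    dsimp only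
    rw [star_mul_eq_neg_of_inner_eq_zero (a := G₁ p) (by rw [real_inner_comm, h01])]
    abel
  have hjn : ‖j‖ = 1 := by rw [hj, norm_mul, norm_star, h0, h1, one_mul]
  have hnn : ‖n p‖ = 2 := by rw [hnp, norm_smul, hjn]; norm_num
  have hn0 : n p ≠ 0 := by
    rw [← norm_ne_zero_iff, hnn]
    norm_num
  have hs₀ : HasFDerivAt (fun q => star (G₀ q)) _ p := hG₀.hasFDerivAt.star
  have hs₁ : HasFDerivAt (fun q => star (G₁ q)) _ p := hG₁.hasFDerivAt.star
  have hdn := (hs₀.mul' hG₁.hasFDerivAt).sub (hs₁.mul' hG₀.hasFDerivAt)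
  have hnd : DifferentiableAt ℝ n p := hdn.differentiableAt
  have hcd : DifferentiableAt ℝ (fun q => ‖n q‖⁻¹) p :=
    (hnd.norm ℝ hn0).inv (norm_ne_zero_iff.2 hn0)
  have hJ := hcd.hasFDerivAt.smul hnd.hasFDerivAt
  refine ⟨hJ.differentiableAt, fun a => ?_⟩
  have e1 : fderiv ℝ n p a = star (G₀ p) * fderiv ℝ G₁ p a + star (fderiv ℝ G₀ p a) * G₁ p
      - (star (G₁ p) * fderiv ℝ G₀ p a + star (fderiv ℝ G₁ p a) * G₀ p) := by
    have : fderiv ℝ n p = _ := hdn.fderiv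
    rw [this]
    simp
  -- At $p$ one has $n=2j$ and $\|n\|=2$, so differentiating the normalizing factor only adds a real
  -- multiple of $j$.
  have e2 : fderiv ℝ (fun q => unitCross (G₀ q) (G₁ q)) p a =
      (1 / 2 : ℝ) • fderiv ℝ n p a + (2 * fderiv ℝ (fun q => ‖n q‖⁻¹) p a) • j := by
    have : fderiv ℝ (fun q => unitCross (G₀ q) (G₁ q)) p = _ := hJ.fderiv
    rw [this]
    simp only [add_apply, smul_apply,
      ContinuousLinearMap.smulRight_apply]
    rw [hnn, hnp]
    module
  set t := star (fderiv ℝ G₀ p a) * G₁ p + star (G₀ p) * fderiv ℝ G₁ p a with ht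
  have e3 : fderiv ℝ n p a = t - star t := by
    rw [e1, ht]
    simp only [star_add, star_mul, star_star]
    abel
  have e4 : t + star t = (2 * t.re : ℝ) • (1 : ℍ) := by
    rw [Quaternion.self_add_star, ← Quaternion.coe_mul_eq_smul, mul_one]
    push_cast
    rfl
  have e5 : star (star (G₀ p) * fderiv ℝ G₀ p a) * j = star (fderiv ℝ G₀ p a) * G₁ p := by
    rw [hj, star_mul, star_star, mul_assoc, ← mul_assoc (G₀ p), self_mul_star_of_norm_eq_one h0,
      one_mul]
  -- Since $\tfrac12(t-\bar t)=t-\operatorname{Re}t$, the error term lies in $\mathbb R+\mathbb Rj$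
  -- and commutes with $j$.
  refine ⟨(-t.re) • (1 : ℍ) + (2 * fderiv ℝ (fun q => ‖n q‖⁻¹) p a) • j, ?_, ?_⟩
  · simp only [add_mul, mul_add, smul_mul_assoc, mul_smul_comm, one_mul, mul_one]
  · rw [e5, ← ht, e2, e3, show t - star t = (2 : ℝ) • t - (t + star t) by module, e4]
    module

theorem unitCross_mul_self {a b : ℍ} (h : star a * b - star b * a ≠ 0) :
    unitCross a b * unitCross a b = -1 :=
  inv_norm_smul_mul_self (by simp) h

theorem eventually_cross_ne_zero (h0 : ‖G₀ p‖ = 1) (h1 : ‖G₁ p‖ = 1)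
    (h01 : inner ℝ (G₀ p) (G₁ p) = 0) (hG₀ : ContinuousAt G₀ p) (hG₁ : ContinuousAt G₁ p) :
    ∀ᶠ q in 𝓝 p, star (G₀ q) * G₁ q - star (G₁ q) * G₀ q ≠ 0 := by
  have hc : ContinuousAt (fun q => star (G₀ q) * G₁ q - star (G₁ q) * G₀ q) p :=
    (hG₀.star.mul hG₁).sub (hG₁.star.mul hG₀)
  refine hc.eventually_ne ?_
  rw [star_mul_eq_neg_of_inner_eq_zero (a := G₁ p) (by rw [real_inner_comm, h01]),
    sub_neg_eq_add, ← two_smul ℝ]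
  refine smul_ne_zero two_ne_zero ?_
  rw [← norm_ne_zero_iff, norm_mul, norm_star, h0, h1]
  norm_num

end GaussMap

theorem fderiv_mul_eq_neg_of_mul_self {E : Type*} [NormedAddCommGroup E] [NormedSpace ℝ E]
    {J : E → ℍ} {p : E} (hJ : DifferentiableAt ℝ J p)
    (hJJ : (fun q => J q * J q) =ᶠ[𝓝 p] fun _ => -1) (a : E) :
    fderiv ℝ J p a * J p = -(J p * fderiv ℝ J p a) := by
  have hd := congrArg (fun l => l a) (hJ.hasFDerivAt.mul' hJ.hasFDerivAt).fderiv
  have he : fderiv ℝ (J * J) p = 0 := by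
    have : J * J =ᶠ[𝓝 p] fun _ => -1 := hJJ
    rw [this.fderiv_eq, fderiv_fun_const]
    rfl
  rw [he] at hd
  rw [eq_neg_iff_add_eq_zero, add_comm]
  simpa using hd.symm

/-! ### Second derivatives: the Gauss map equation and minimality. -/

section SecondOrder

variable {M : Type*} [TopologicalSpace M] [ChartedSpace (EuclideanSpace ℝ (Fin 2)) M]

/-- A map from a surface, read in the chart at `x`. -/
def inChart (f : M → ℍ) (x : M) : EuclideanSpace ℝ (Fin 2) → ℍ := f ∘ (extChartAt (𝓡 2) x).symm

/-- The second derivative at `x` of a map, in the chart at `x`. -/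
def chartHess (f : M → ℍ) (x : M) (u v : EuclideanSpace ℝ (Fin 2)) : ℍ :=
  fderiv ℝ (fderiv ℝ (inChart f x)) (extChartAt (𝓡 2) x x) u v

variable {f : M → ℍ} {x : M}

theorem ContMDiffAt.contDiffAt_inChart (hf : ContMDiffAt (𝓡 2) 𝓘(ℝ, ℍ) ∞ f x) :
    ContDiffAt ℝ ∞ (inChart f x) (extChartAt (𝓡 2) x x) :=
  hf.contDiffAt_comp_chart_symm

theorem ContMDiffAt.contDiffAt_fderiv_inChart (hf : ContMDiffAt (𝓡 2) 𝓘(ℝ, ℍ) ∞ f x) :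
    ContDiffAt ℝ ∞ (fderiv ℝ (inChart f x)) (extChartAt (𝓡 2) x x) :=
  hf.contDiffAt_inChart.fderiv_right (m := ∞) (by simp)

theorem ContMDiffAt.eventually_differentiableAt_inChart
    (hf : ContMDiffAt (𝓡 2) 𝓘(ℝ, ℍ) ∞ f x) :
    ∀ᶠ q in 𝓝 (extChartAt (𝓡 2) x x), DifferentiableAt ℝ (inChart f x) q := by
  have h : ContDiffAt ℝ 1 (inChart f x) (extChartAt (𝓡 2) x x) :=
    hf.contDiffAt_inChart.of_le (by simp)
  filter_upwards [h.eventually (by simp)] with q hq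
  exact hq.differentiableAt (by simp)

theorem ContMDiffAt.hasFDerivAt_fderiv_inChart (hf : ContMDiffAt (𝓡 2) 𝓘(ℝ, ℍ) ∞ f x)
    (a : EuclideanSpace ℝ (Fin 2)) :
    HasFDerivAt (fun q => fderiv ℝ (inChart f x) q a)
      ((fderiv ℝ (fderiv ℝ (inChart f x)) (extChartAt (𝓡 2) x x)).flip a)
      (extChartAt (𝓡 2) x x) := by
  have h := (hf.contDiffAt_fderiv_inChart.differentiableAt (by simp)).hasFDerivAt
  have := h.clm_apply (hasFDerivAt_const a _)
  simpa using this

theorem ContMDiffAt.chartHess_comm (hf : ContMDiffAt (𝓡 2) 𝓘(ℝ, ℍ) ∞ f x)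
    (u v : EuclideanSpace ℝ (Fin 2)) : chartHess f x u v = chartHess f x v u :=
  (hf.contDiffAt_inChart.isSymmSndFDerivAt (by
    rw [minSmoothness_of_isRCLikeNormedField]
    exact WithTop.coe_le_coe.2 (le_top (a := (2 : ℕ∞))))).eq u v

variable [IsManifold (𝓡 2) ∞ M]

theorem dmap_eq_fderiv_inChart {y : M}
    (hy : y ∈ (chartAt (EuclideanSpace ℝ (Fin 2)) x).source)
    (hf : DifferentiableAt ℝ (inChart f x) (extChartAt (𝓡 2) x y)) (v : TangentSpace (𝓡 2) y) :
    dmap f y v = fderiv ℝ (inChart f x) (extChartAt (𝓡 2) x y) (chartDeriv x y v) :=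
  dmap_of_comp_chart hy (eventuallyEq_comp_chart_symm f hy) hf v

theorem ContMDiffAt.dmap_eq (hf : ContMDiffAt (𝓡 2) 𝓘(ℝ, ℍ) ∞ f x) (v : TangentSpace (𝓡 2) x) :
    dmap f x v = fderiv ℝ (inChart f x) (extChartAt (𝓡 2) x x) (chartDeriv x x v) :=
  dmap_eq_fderiv_inChart (mem_chart_source _ _)
    hf.eventually_differentiableAt_inChart.self_of_nhds v

theorem chartDeriv_injective {y : M}
    (hy : y ∈ (chartAt (EuclideanSpace ℝ (Fin 2)) x).source) :
    Function.Injective (chartDeriv x y) :=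
  (isInvertible_mfderiv_extChartAt (by rwa [extChartAt_source])).injective

/-- Near `x`, the Gauss map `jL` is given by the partial derivatives of `f` in the chart at `x`. -/
theorem jL_eventuallyEq (o : SurfaceOrientation M) (hf : IsSmoothImmersion f)
    {w : Fin 2 → TangentSpace (𝓡 2) x} (hw : IsOrientedFrame f o x w) :
    jL f o =ᶠ[𝓝 x] (fun q => unitCross (fderiv ℝ (inChart f x) q (chartDeriv x x (w 0)))
      (fderiv ℝ (inChart f x) q (chartDeriv x x (w 1)))) ∘ extChartAt (𝓡 2) x := by
  -- The frame $w$ extended with constant coefficients in the chart. It is orthonormal at $x$ only,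
  -- but stays positive nearby, which suffices for `jL_eq_of_positiveBasis`.
  set X : Fin 2 → ∀ y : M, TangentSpace (𝓡 2) y :=
    fun i y => Function.invFun (chartDeriv x y) (chartDeriv x x (w i)) with hX
  have hXa : ∀ y ∈ (chartAt (EuclideanSpace ℝ (Fin 2)) x).source, ∀ i,
      chartDeriv x y (X i y) = chartDeriv x x (w i) :=
    fun y hy i => Function.invFun_eq (chartDeriv_surjective hy _)
  have hXx : ∀ i, X i x = w i := fun i =>
    Function.leftInverse_invFun (chartDeriv_injective (mem_chart_source _ _)) (w i)
  have hpos : IsPositiveBasis (o.at' x) (fun i => X i x) := by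
    simp only [hXx]
    exact hw.2
  filter_upwards [eventually_isPositiveBasis o x _ hXa hpos,
    chart_source_mem_nhds (EuclideanSpace ℝ (Fin 2)) x,
    eventually_comp_chart x _ (hf.1.contMDiffAt.eventually_differentiableAt_inChart (x := x))]
    with y hy hys hyd
  rw [jL_eq_of_positiveBasis (hf.2 y) hy]
  simp only [dmap_eq_fderiv_inChart hys hyd, hXa y hys]
  rfl

/-- The Gauss map in the chart at `x`, up to orientation: the unit imaginary quaternion of the
plane spanned by the derivatives of `f` in two fixed directions. -/
def gaussInChart (f : M → ℍ) (x : M) (a b q : EuclideanSpace ℝ (Fin 2)) : ℍ :=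
  unitCross (fderiv ℝ (inChart f x) q a) (fderiv ℝ (inChart f x) q b)

theorem jL_eq_star_mul (o : SurfaceOrientation M) {w : Fin 2 → TangentSpace (𝓡 2) x}
    (hw : IsOrientedFrame f o x w) : jL f o x = star (dmap f x (w 0)) * dmap f x (w 1) := by
  rw [jL_eq w hw, vecMul_eq_of_inner_eq_zero (hw.1.2 (by decide))]

theorem gaussInChart_derivative (hf : ContMDiffAt (𝓡 2) 𝓘(ℝ, ℍ) ∞ f x)
    {w : Fin 2 → TangentSpace (𝓡 2) x} (hw : Orthonormal ℝ (fun i => dmap f x (w i))) :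
    DifferentiableAt ℝ (gaussInChart f x (chartDeriv x x (w 0)) (chartDeriv x x (w 1)))
      (extChartAt (𝓡 2) x x) ∧
    ∀ u, ∃ c : ℍ, c * (star (dmap f x (w 0)) * dmap f x (w 1)) =
        star (dmap f x (w 0)) * dmap f x (w 1) * c ∧
      fderiv ℝ (gaussInChart f x (chartDeriv x x (w 0)) (chartDeriv x x (w 1)))
        (extChartAt (𝓡 2) x x) u =
      star (star (dmap f x (w 0)) * chartHess f x u (chartDeriv x x (w 0)))
        * (star (dmap f x (w 0)) * dmap f x (w 1))
      + star (dmap f x (w 0)) * chartHess f x u (chartDeriv x x (w 1)) + c := by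
  have h0 : ‖dmap f x (w 0)‖ = 1 := hw.1 0
  have h1 : ‖dmap f x (w 1)‖ = 1 := hw.1 1
  have h01 : inner ℝ (dmap f x (w 0)) (dmap f x (w 1)) = 0 := hw.2 (by decide)
  rw [hf.dmap_eq (w 0)] at h0 h01 ⊢
  rw [hf.dmap_eq (w 1)] at h1 h01 ⊢
  have hG₀ := hf.hasFDerivAt_fderiv_inChart (chartDeriv x x (w 0))
  have hG₁ := hf.hasFDerivAt_fderiv_inChart (chartDeriv x x (w 1))
  have hJ := exists_fderiv_unitCross (G₀ := fun q => fderiv ℝ (inChart f x) q (chartDeriv x x (w 0)))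
    (G₁ := fun q => fderiv ℝ (inChart f x) q (chartDeriv x x (w 1))) (p := extChartAt (𝓡 2) x x)
    h0 h1 h01 hG₀.differentiableAt hG₁.differentiableAt
  rw [hG₀.fderiv, hG₁.fderiv] at hJ
  exact hJ

theorem gaussInChart_mul_self (hf : ContMDiffAt (𝓡 2) 𝓘(ℝ, ℍ) ∞ f x)
    {w : Fin 2 → TangentSpace (𝓡 2) x} (hw : Orthonormal ℝ (fun i => dmap f x (w i))) :
    ∀ᶠ q in 𝓝 (extChartAt (𝓡 2) x x),
      gaussInChart f x (chartDeriv x x (w 0)) (chartDeriv x x (w 1)) q *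
      gaussInChart f x (chartDeriv x x (w 0)) (chartDeriv x x (w 1)) q = -1 := by
  have h0 : ‖dmap f x (w 0)‖ = 1 := hw.1 0
  have h1 : ‖dmap f x (w 1)‖ = 1 := hw.1 1
  have h01 : inner ℝ (dmap f x (w 0)) (dmap f x (w 1)) = 0 := hw.2 (by decide)
  rw [hf.dmap_eq (w 0)] at h0 h01
  rw [hf.dmap_eq (w 1)] at h1 h01
  filter_upwards [eventually_cross_ne_zero (G₀ := fun q => fderiv ℝ (inChart f x) q (chartDeriv x x (w 0)))
    (G₁ := fun q => fderiv ℝ (inChart f x) q (chartDeriv x x (w 1))) (p := extChartAt (𝓡 2) x x)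
    h0 h1 h01
    (hf.hasFDerivAt_fderiv_inChart (chartDeriv x x (w 0))).continuousAt
    (hf.hasFDerivAt_fderiv_inChart (chartDeriv x x (w 1))).continuousAt] with q hq
  exact unitCross_mul_self hq

theorem mdifferentiableAt_jL (o : SurfaceOrientation M) (hf : IsSmoothImmersion f) (x : M) :
    MDifferentiableAt (𝓡 2) 𝓘(ℝ, ℍ) (jL f o) x := by
  obtain ⟨w, hw⟩ := exists_isOrientedFrame o (hf.2 x)
  exact (HasMFDerivAt.of_comp_chart (mem_chart_source _ _) (jL_eventuallyEq o hf hw)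
    (gaussInChart_derivative hf.1.contMDiffAt hw.1).1).mdifferentiableAt

theorem dmap_jL (o : SurfaceOrientation M) (hf : IsSmoothImmersion f)
    {w : Fin 2 → TangentSpace (𝓡 2) x} (hw : IsOrientedFrame f o x w) (v : TangentSpace (𝓡 2) x) :
    dmap (jL f o) x v = fderiv ℝ (gaussInChart f x (chartDeriv x x (w 0)) (chartDeriv x x (w 1)))
      (extChartAt (𝓡 2) x x) (chartDeriv x x v) :=
  dmap_of_comp_chart (mem_chart_source _ _) (jL_eventuallyEq o hf hw)
    (gaussInChart_derivative hf.1.contMDiffAt hw.1).1 v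

theorem dmap_jL_mul (o : SurfaceOrientation M) (hf : IsSmoothImmersion f)
    (v : TangentSpace (𝓡 2) x) :
    dmap (jL f o) x v * jL f o x = -(jL f o x * dmap (jL f o) x v) := by
  obtain ⟨w, hw⟩ := exists_isOrientedFrame o (hf.2 x)
  have hJ : jL f o x = gaussInChart f x (chartDeriv x x (w 0)) (chartDeriv x x (w 1))
      (extChartAt (𝓡 2) x x) := (jL_eventuallyEq o hf hw).self_of_nhds
  rw [dmap_jL o hf hw, hJ]
  exact fderiv_mul_eq_neg_of_mul_self (gaussInChart_derivative hf.1.contMDiffAt hw.1).1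
    (gaussInChart_mul_self hf.1.contMDiffAt hw.1) _

/-- The derivative of the Gauss map `jL`. -/
theorem exists_dmap_jL_eq (o : SurfaceOrientation M) (hf : IsSmoothImmersion f)
    {w : Fin 2 → TangentSpace (𝓡 2) x} (hw : IsOrientedFrame f o x w) (v : TangentSpace (𝓡 2) x) :
    ∃ c : ℍ, c * jL f o x = jL f o x * c ∧ dmap (jL f o) x v =
      star (star (dmap f x (w 0)) * chartHess f x (chartDeriv x x v) (chartDeriv x x (w 0)))
        * jL f o x
      + star (dmap f x (w 0)) * chartHess f x (chartDeriv x x v) (chartDeriv x x (w 1)) + c := by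
  rw [dmap_jL o hf hw, jL_eq_star_mul o hw]
  exact (gaussInChart_derivative hf.1.contMDiffAt hw.1).2 _

/-- The normal part of the trace of the second derivative vanishes, i.e. the mean curvature
vector is zero. -/
def MeanCurvatureZero (f : M → ℍ) (x : M) (w : Fin 2 → TangentSpace (𝓡 2) x) : Prop :=
  ∀ ν : ℍ, inner ℝ ν (dmap f x (w 0)) = 0 → inner ℝ ν (dmap f x (w 1)) = 0 →
    inner ℝ ν (chartHess f x (chartDeriv x x (w 0)) (chartDeriv x x (w 0)) +
      chartHess f x (chartDeriv x x (w 1)) (chartDeriv x x (w 1))) = 0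

/-- On the tangent space of the sphere of unit imaginary quaternions, right multiplication by $j_L$
is a rotation by a right angle; the left side is thus a Cauchy-Riemann equation for the Gauss map.
-/
theorem dmap_jL_eq_iff (o : SurfaceOrientation M) (hf : IsSmoothImmersion f)
    {w : Fin 2 → TangentSpace (𝓡 2) x} (hw : IsOrientedFrame f o x w) :
    dmap (jL f o) x (w 0) = dmap (jL f o) x (w 1) * jL f o x ↔ MeanCurvatureZero f x w := by
  have ha := fun v => dmap_jL_mul o hf (x := x) v
  have hfx : ContMDiffAt (𝓡 2) 𝓘(ℝ, ℍ) ∞ f x := hf.1.contMDiffAt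
  have hjj := jL_mul_self (o := o) (hf.2 x)
  obtain ⟨c₀, hc₀, e₀⟩ := exists_dmap_jL_eq o hf hw (w 0)
  obtain ⟨c₁, hc₁, e₁⟩ := exists_dmap_jL_eq o hf hw (w 1)
  -- Symmetry of the second derivative supplies the common mixed term required by
  -- `gaussMap_eq_iff_commute`.
  rw [hfx.chartHess_comm (chartDeriv x x (w 1)) (chartDeriv x x (w 0))] at e₁
  rw [gaussMap_eq_iff_commute hjj (ha _) (ha _) e₀ e₁ hc₀ hc₁, ← mul_add,
    commute_iff_forall_normal hjj (hw.1.1 0) (hw.1.1 1) (jL_eq_star_mul o hw).symm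
      (hw.1.2 (by decide))]
  rfl

/-- Differentiating `⟨ν, df⟩ = 0`. -/
theorem inner_dmap_normal (hf : IsSmoothImmersion f) {ν : M → ℍ}
    (hν : ContMDiffAt (𝓡 2) 𝓘(ℝ, ℍ) ∞ ν x)
    (hn : ∀ᶠ y in 𝓝 x, ∀ v : TangentSpace (𝓡 2) y, inner ℝ (ν y) (dmap f y v) = 0)
    (u v : TangentSpace (𝓡 2) x) : inner ℝ (dmap ν x u) (dmap f x v) =
      -inner ℝ (ν x) (chartHess f x (chartDeriv x x u) (chartDeriv x x v)) := by
  have hfx : ContMDiffAt (𝓡 2) 𝓘(ℝ, ℍ) ∞ f x := hf.1.contMDiffAt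
  have hev : (fun q => inner ℝ (inChart ν x q) (fderiv ℝ (inChart f x) q (chartDeriv x x v)))
      =ᶠ[𝓝 (extChartAt (𝓡 2) x x)] fun _ => (0 : ℝ) := by
    filter_upwards [eventually_chart_symm x _ hn, eventually_mem_chart_target x,
      hfx.eventually_differentiableAt_inChart] with q hq hqt hqd
    have hys : (extChartAt (𝓡 2) x).symm q ∈ (chartAt (EuclideanSpace ℝ (Fin 2)) x).source := by
      rw [← extChartAt_source (𝓡 2)]
      exact (extChartAt (𝓡 2) x).map_target hqt
    have hqq : extChartAt (𝓡 2) x ((extChartAt (𝓡 2) x).symm q) = q :=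
      (extChartAt (𝓡 2) x).right_inv hqt
    obtain ⟨z, hz⟩ := chartDeriv_surjective hys (chartDeriv x x v)
    have := hq z
    rw [dmap_eq_fderiv_inChart hys (by rwa [hqq]), hz, hqq] at this
    exact this
  have hN : HasFDerivAt (inChart ν x) _ (extChartAt (𝓡 2) x x) :=
    hν.eventually_differentiableAt_inChart.self_of_nhds.hasFDerivAt
  have hG := hfx.hasFDerivAt_fderiv_inChart (chartDeriv x x v)
  have h1 := congrArg (fun l => l (chartDeriv x x u)) (hN.inner ℝ hG).fderiv
  rw [hev.fderiv_eq] at h1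
  have hνx : inChart ν x (extChartAt (𝓡 2) x x) = ν x := by
    rw [inChart, Function.comp_apply, extChartAt_to_inv]
  simp [fderivInnerCLM_apply, hνx, -extChartAt] at h1
  rw [hν.dmap_eq u, hfx.dmap_eq v]
  rw [chartHess]
  linarith

/-- Every normal vector at a point extends to a smooth normal field. -/
theorem exists_normal_extension (hf : IsSmoothImmersion f) {w : Fin 2 → TangentSpace (𝓡 2) x}
    (hw : Orthonormal ℝ (fun i => dmap f x (w i)))
    (hspan : ∀ v : TangentSpace (𝓡 2) x, ∃ a b : ℝ, v = a • w 0 + b • w 1) {ν₀ : ℍ}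
    (h0 : inner ℝ ν₀ (dmap f x (w 0)) = 0) (h1 : inner ℝ ν₀ (dmap f x (w 1)) = 0) :
    ∃ ν : M → ℍ, ContMDiffAt (𝓡 2) 𝓘(ℝ, ℍ) ∞ ν x ∧ ν x = ν₀ ∧
      ∀ᶠ y in 𝓝 x, ∀ v : TangentSpace (𝓡 2) y, inner ℝ (ν y) (dmap f y v) = 0 := by
  have hfx : ContMDiffAt (𝓡 2) 𝓘(ℝ, ℍ) ∞ f x := hf.1.contMDiffAt
  set G : Fin 2 → EuclideanSpace ℝ (Fin 2) → ℍ :=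
    fun i q => fderiv ℝ (inChart f x) q (chartDeriv x x (w i)) with hG
  have hGs : ∀ i, ContDiffAt ℝ ∞ (G i) (extChartAt (𝓡 2) x x) := fun i =>
    hfx.contDiffAt_fderiv_inChart.clm_apply contDiffAt_const
  -- The normal projection of $\nu_0$ by Cramer's rule, multiplied by the Gram determinant to avoid
  -- division. At $x$ the determinant is $1$ and the corrections vanish, so the value there is
  -- $\nu_0$.
  set N : EuclideanSpace ℝ (Fin 2) → ℍ := fun q =>
    (inner ℝ (G 0 q) (G 0 q) * inner ℝ (G 1 q) (G 1 q) - inner ℝ (G 0 q) (G 1 q) ^ 2) • ν₀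
    - (inner ℝ (G 1 q) (G 1 q) * inner ℝ ν₀ (G 0 q)
      - inner ℝ (G 0 q) (G 1 q) * inner ℝ ν₀ (G 1 q)) • G 0 q
    - (inner ℝ (G 0 q) (G 0 q) * inner ℝ ν₀ (G 1 q)
      - inner ℝ (G 0 q) (G 1 q) * inner ℝ ν₀ (G 0 q)) • G 1 q with hN
  have hN0 : ∀ q, inner ℝ (N q) (G 0 q) = 0 := fun q => by
    simp only [hN, inner_sub_left, real_inner_smul_left]
    rw [real_inner_comm (G 0 q) (G 1 q)]
    ring
  have hN1 : ∀ q, inner ℝ (N q) (G 1 q) = 0 := fun q => by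
    simp only [hN, inner_sub_left, real_inner_smul_left]
    ring
  have hNs : ContDiffAt ℝ ∞ N (extChartAt (𝓡 2) x x) := by
    have c : ContDiffAt ℝ ∞ (fun _ : EuclideanSpace ℝ (Fin 2) => ν₀) (extChartAt (𝓡 2) x x) :=
      contDiffAt_const
    have i00 := (hGs 0).inner ℝ (hGs 0)
    have i01 := (hGs 0).inner ℝ (hGs 1)
    have i11 := (hGs 1).inner ℝ (hGs 1)
    have c0 := c.inner ℝ (hGs 0)
    have c1 := c.inner ℝ (hGs 1)
    exact ((((i00.mul i11).sub (i01.pow 2)).smul c).sub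
      (((i11.mul c0).sub (i01.mul c1)).smul (hGs 0))).sub
      (((i00.mul c1).sub (i01.mul c0)).smul (hGs 1))
  refine ⟨N ∘ extChartAt (𝓡 2) x, ?_, ?_, ?_⟩
  · exact hNs.contMDiffAt.comp x contMDiffAt_extChartAt
  · have g : ∀ i, G i (extChartAt (𝓡 2) x x) = dmap f x (w i) := fun i => (hfx.dmap_eq (w i)).symm
    have n : ∀ i, inner ℝ (dmap f x (w i)) (dmap f x (w i)) = 1 := fun i => by
      rw [real_inner_self_eq_norm_sq, hw.1 i, one_pow]
    have n01 : inner ℝ (dmap f x (w 0)) (dmap f x (w 1)) = 0 := hw.2 (by decide)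
    simp only [Function.comp_apply, hN, g, n, n01, h0, h1]
    module
  · filter_upwards [chart_source_mem_nhds (EuclideanSpace ℝ (Fin 2)) x,
      eventually_comp_chart x _ hfx.eventually_differentiableAt_inChart] with y hys hyd v
    obtain ⟨z, hz⟩ := chartDeriv_surjective (mem_chart_source _ x) (chartDeriv x y v)
    obtain ⟨a, b, rfl⟩ := hspan z
    rw [dmap_eq_fderiv_inChart hys hyd, ← hz]
    simp only [map_add, map_smul, inner_add_right, inner_smul_right, Function.comp_apply]
    have e0 := hN0 (extChartAt (𝓡 2) x y)
    have e1 := hN1 (extChartAt (𝓡 2) x y)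
    simp only [hG] at e0 e1
    rw [e0, e1]
    simp

theorem exists_eq_smul_add_smul_of_orthonormal (o : SurfaceOrientation M)
    {w : Fin 2 → TangentSpace (𝓡 2) x} (hw : Orthonormal ℝ (fun i => dmap f x (w i)))
    (v : TangentSpace (𝓡 2) x) : ∃ a b : ℝ, v = a • w 0 + b • w 1 := by
  obtain ⟨X, hX⟩ := o.exists_positiveBasis x
  rcases isPositiveBasis_or_swap (dmap f x).toLinearMap hX hw with ⟨b, hb, -⟩ | ⟨b, hb, -⟩
  · refine ⟨b.repr v 0, b.repr v 1, ?_⟩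
    have := b.sum_repr v
    rw [Fin.sum_univ_two, hb] at this
    exact this.symm
  · refine ⟨b.repr v 1, b.repr v 0, ?_⟩
    have := b.sum_repr v
    rw [Fin.sum_univ_two, hb] at this
    rw [add_comm]
    exact this.symm

/-- By `inner_dmap_normal` the trace of $A^\nu$ is minus the inner product of $\nu$ with the trace
of the second derivative, and every normal vector at a point is the value of a normal field. -/
theorem isMinimalImmersion_iff (o : SurfaceOrientation M) (hf : IsSmoothImmersion f) :
    IsMinimalImmersion f ↔ ∀ (x : M) (w : Fin 2 → TangentSpace (𝓡 2) x), IsOrientedFrame f o x w →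
      MeanCurvatureZero f x w := by
  constructor
  · intro h x w hw ν₀ h0 h1
    obtain ⟨ν, hν, rfl, hn⟩ := exists_normal_extension hf hw.1
      (exists_eq_smul_add_smul_of_orthonormal o hw.1) h0 h1
    have := h x ν hν hn w hw.1
    rw [Fin.sum_univ_two, inner_dmap_normal hf hν hn, inner_dmap_normal hf hν hn] at this
    rw [inner_add_right]
    linarith
  · intro h x ν hν hn w hw
    rw [Fin.sum_univ_two, inner_dmap_normal hf hν hn, inner_dmap_normal hf hν hn]
    have hnx := hn.self_of_nhds
    obtain ⟨X, hX⟩ := o.exists_positiveBasis x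
    rcases isPositiveBasis_or_swap (dmap f x).toLinearMap hX hw with hp | hp
    · have := h x w ⟨hw, hp⟩ (ν x) (hnx _) (hnx _)
      rw [inner_add_right] at this
      linarith
    · have hw' : Orthonormal ℝ (fun i => dmap f x ((![w 1, w 0] : Fin 2 → _) i)) := by
        convert! hw.comp _ (Equiv.swap (0 : Fin 2) 1).injective using 1
        ext i : 1
        fin_cases i <;> rfl
      have := h x _ ⟨hw', hp⟩ (ν x) (hnx _) (hnx _)
      rw [inner_add_right] at this
      simp only [Matrix.cons_val_zero, Matrix.cons_val_one] at this
      linarith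

end SecondOrder

/-! ### Tangent spaces of $X_\psi$. -/

section Twisted

theorem HasDerivAt.octMk {a b : ℝ → ℍ} {a' b' : ℍ} {t : ℝ} (ha : HasDerivAt a a' t)
    (hb : HasDerivAt b b' t) : HasDerivAt (fun s => octMk (a s) (b s)) (octMk a' b') t :=
  (WithLp.prodContinuousLinearEquiv 2 ℝ ℍ ℍ).symm.toContinuousLinearMap.hasFDerivAt.comp_hasDerivAt
    t (ha.prodMk hb)

variable {M : Type*} [TopologicalSpace M] [ChartedSpace (EuclideanSpace ℝ (Fin 2)) M]

theorem HasMFDerivAt.hasDerivAt_comp_curve {g : M → ℍ} {γ : ℝ → M}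
    (hg : MDifferentiableAt (𝓡 2) 𝓘(ℝ, ℍ) g (γ 0))
    {γ' : TangentSpace 𝓘(ℝ, ℝ) (0 : ℝ) →L[ℝ] TangentSpace (𝓡 2) (γ 0)}
    (hγ : HasMFDerivAt 𝓘(ℝ, ℝ) (𝓡 2) γ 0 γ') :
    HasDerivAt (fun t => g (γ t)) (dmap g (γ 0) (γ' (1 : ℝ))) 0 :=
  HasFDerivAt.hasDerivAt (f' := (dmap g (γ 0)).comp γ')
    (hasMFDerivAt_iff_hasFDerivAt.1 (hg.hasMFDerivAt.comp (0 : ℝ) hγ))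

variable [IsManifold (𝓡 2) ∞ M]

/-- Every tangent vector is the velocity of a curve. -/
theorem exists_curve_of_tangent (x : M) (v : TangentSpace (𝓡 2) x) :
    ∃ γ : ℝ → M, γ 0 = x ∧ MDifferentiableAt 𝓘(ℝ, ℝ) (𝓡 2) γ 0 ∧
      ∀ g : M → ℍ, MDifferentiableAt (𝓡 2) 𝓘(ℝ, ℍ) g x →
        HasDerivAt (fun t => g (γ t)) (dmap g x v) 0 := by
  have hsymm : MDifferentiableAt 𝓘(ℝ, EuclideanSpace ℝ (Fin 2)) (𝓡 2) (extChartAt (𝓡 2) x).symm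
      (extChartAt (𝓡 2) x x) := by
    have h := mdifferentiableWithinAt_extChartAt_symm (mem_extChartAt_target (I := 𝓡 2) x)
    rwa [ModelWithCorners.range_eq_univ, mdifferentiableWithinAt_univ] at h
  set l : ℝ → EuclideanSpace ℝ (Fin 2) :=
    fun t => extChartAt (𝓡 2) x x + t • chartDeriv x x v with hl
  have hl0 : l 0 = extChartAt (𝓡 2) x x := by rw [hl]; simp only [zero_smul, add_zero]
  have hld : HasDerivAt l (chartDeriv x x v) 0 := by
    have h := ((hasDerivAt_id (0 : ℝ)).smul_const (chartDeriv x x v)).const_add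
      (extChartAt (𝓡 2) x x)
    rwa [one_smul] at h
  refine ⟨(extChartAt (𝓡 2) x).symm ∘ l, ?_, ?_, fun g hg => ?_⟩
  · rw [Function.comp_apply, hl0, extChartAt_to_inv]
  · refine MDifferentiableAt.comp (0 : ℝ) (I' := 𝓘(ℝ, EuclideanSpace ℝ (Fin 2))) ?_
      hld.differentiableAt.mdifferentiableAt
    rwa [hl0]
  · have hgd : DifferentiableAt ℝ (inChart g x) (extChartAt (𝓡 2) x x) := by
      rw [← mdifferentiableAt_iff_differentiableAt]
      refine MDifferentiableAt.comp _ (I' := 𝓡 2) ?_ hsymm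
      rwa [extChartAt_to_inv]
    rw [dmap_eq_fderiv_inChart (mem_chart_source _ x) hgd]
    have h2 := hgd.hasFDerivAt
    rw [← hl0] at h2 ⊢
    exact h2.comp_hasDerivAt (0 : ℝ) hld

variable {j I : M → ℍ} {V : M → Submodule ℝ ℍ} {f ψ : M → ℍ} {x : M}

/-- The tangent space of `X_ψ`, for a field `V` of eigenspaces `{s | s j = I s}`. -/
theorem twistedTangent_eq (hI : ∀ y, I y * I y = -1) (hj : ∀ y, j y * j y = -1)
    (hV : ∀ y s, s ∈ V y ↔ s * j y = I y * s) (hId : MDifferentiableAt (𝓡 2) 𝓘(ℝ, ℍ) I x)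
    (hjd : MDifferentiableAt (𝓡 2) 𝓘(ℝ, ℍ) j x) (hf : MDifferentiableAt (𝓡 2) 𝓘(ℝ, ℍ) f x)
    (hψ : MDifferentiableAt (𝓡 2) 𝓘(ℝ, ℍ) ψ x)
    (hjj : ∀ v, dmap j x v * j x = -(j x * dmap j x v)) {w : Fin 2 → TangentSpace (𝓡 2) x}
    (hw : ∀ v, ∃ a b : ℝ, v = a • w 0 + b • w 1) {χ : ℍ} (hχ : χ ∈ V x) :
    twistedTangent f V ψ x χ = {u | ∃ s ∈ V x, ∃ a b : ℝ, u = octMk (s +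
      (a • ((1 / 2 : ℝ) • ((χ * dmap j x (w 0) - dmap I x (w 0) * χ) * j x)
          + nablaMinus V ψ x (w 0))
        + b • ((1 / 2 : ℝ) • ((χ * dmap j x (w 1) - dmap I x (w 1) * χ) * j x)
          + nablaMinus V ψ x (w 1))))
      (a • dmap f x (w 0) + b • dmap f x (w 1))} := by
  set L : TangentSpace (𝓡 2) x → ℍ := fun v =>
    (1 / 2 : ℝ) • ((χ * dmap j x v - dmap I x v * χ) * j x) + nablaMinus V ψ x v with hL
  have hLlin : ∀ a b : ℝ, L (a • w 0 + b • w 1) = a • L (w 0) + b • L (w 1) := fun a b => by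
    simp only [hL, nablaMinus, map_add, map_smul, mul_add, add_mul, sub_mul,
      mul_smul_comm, smul_mul_assoc]
    module
  have hflin : ∀ a b : ℝ, dmap f x (a • w 0 + b • w 1) =
      a • dmap f x (w 0) + b • dmap f x (w 1) := fun a b => by
    rw [map_add, map_smul, map_smul]
  have hnabla : ∀ v, nablaMinus V ψ x v =
      (1 / 2 : ℝ) • (dmap ψ x v + I x * dmap ψ x v * j x) := fun v =>
    starProjection_orthogonal_eigenspace (hI x) (hj x) (hV x) _
  have hχ' := (hV x χ).1 hχ
  ext u
  constructor
  · rintro ⟨γ, c, rfl, hc0, hγ, hc, hcV, hu⟩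
    obtain ⟨a, b, hv⟩ := hw (mfderiv 𝓘(ℝ, ℝ) (𝓡 2) γ 0 (1 : ℝ))
    have hd : ∀ g : M → ℍ, MDifferentiableAt (𝓡 2) 𝓘(ℝ, ℍ) g (γ 0) →
        HasDerivAt (fun t => g (γ t)) (dmap g (γ 0) (a • w 0 + b • w 1)) 0 := fun g hg => by
      rw [← hv]
      exact HasMFDerivAt.hasDerivAt_comp_curve hg hγ.hasMFDerivAt
    have hcd := hc.hasDerivAt
    set c' := deriv c 0 with hc'
    set v := a • w 0 + b • w 1 with hvdef
    have hu' : u = octMk (c' + dmap ψ (γ 0) v) (dmap f (γ 0) v) :=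
      hu.unique ((hcd.add (hd ψ hψ)).octMk (hd f hf))
    -- Differentiating the constraint $c\,j=I\,c$. It determines $c'+Ic'j$, twice the $V^\perp$
    -- component of $c'$, and leaves the $V$ component free.
    have hconstr : c' * j (γ 0) + c 0 * dmap j (γ 0) v =
        dmap I (γ 0) v * c 0 + I (γ 0) * c' := by
      refine HasDerivAt.unique (hcd.mul (hd j hjd)) (((hd I hId).mul hcd).congr_of_eventuallyEq ?_)
      filter_upwards [hcV] with t ht
      exact (hV _ _).1 ht
    rw [hc0] at hconstr
    refine ⟨c' + dmap ψ (γ 0) v - L v, ?_, a, b, ?_⟩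
    · have h1 : (χ * dmap j (γ 0) v - dmap I (γ 0) v * χ) * j (γ 0) = c' + I (γ 0) * c' * j (γ 0) := by
        have : χ * dmap j (γ 0) v - dmap I (γ 0) v * χ = I (γ 0) * c' - c' * j (γ 0) := by
          rw [sub_eq_sub_iff_add_eq_add, add_comm, hconstr, add_comm]
        rw [this, sub_mul, mul_assoc c', hj]
        noncomm_ring
      have : c' + dmap ψ (γ 0) v - L v = (1 / 2 : ℝ) • ((c' + dmap ψ (γ 0) v) -
          I (γ 0) * (c' + dmap ψ (γ 0) v) * j (γ 0)) := by
        rw [hL]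
        simp only [h1, hnabla, mul_add, add_mul]
        module
      rw [this]
      exact Submodule.smul_mem _ _ (proj_mem_eigenspace (hI _) (hj _) (hV _) _)
    · rw [hu', ← hLlin, ← hflin, ← hvdef, sub_add_cancel]
  · rintro ⟨s, hs, a, b, rfl⟩
    rw [← hLlin, ← hflin]
    set v := a • w 0 + b • w 1 with hvdef
    obtain ⟨γ, rfl, hγ, hd⟩ := exists_curve_of_tangent x v
    -- The $V$ component of $d\psi(v)$ is removed in advance, since the velocity of $\psi$ along the
    -- curve adds it back.
    set s' := s - (1 / 2 : ℝ) • (dmap ψ (γ 0) v - I (γ 0) * dmap ψ (γ 0) v * j (γ 0)) with hs'def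
    have hs' : s' ∈ V (γ 0) := sub_mem hs
      (Submodule.smul_mem _ _ (proj_mem_eigenspace (hI _) (hj _) (hV _) _))
    have hs'j := (hV _ _).1 hs'
    have hlin : HasDerivAt (fun t : ℝ => χ + t • s') s' 0 := by
      simpa using ((hasDerivAt_id (0 : ℝ)).smul_const s').const_add χ
    have hcd := (hlin.sub (((hd I hId).mul hlin).mul (hd j hjd))).const_smul (1 / 2 : ℝ)
    -- The line $\chi+ts'$ projected onto the moving space $V_{\gamma(t)}$.
    refine ⟨γ, fun t => (1 / 2 : ℝ) • ((χ + t • s') - I (γ t) * (χ + t • s') * j (γ t)), rfl, ?_,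
      hγ, hcd.differentiableAt, Filter.Eventually.of_forall fun t =>
        Submodule.smul_mem _ _ (proj_mem_eigenspace (hI _) (hj _) (hV _) _), ?_⟩
    · simp only [zero_smul, add_zero]
      rw [← hχ', mul_assoc, hj, mul_neg_one]
      module
    · have h := (hcd.add (hd ψ hψ)).octMk (hd f hf)
      refine h.congr_deriv ?_
      congr 1
      have e : I (γ 0) * χ * dmap j (γ 0) v = -(χ * dmap j (γ 0) v * j (γ 0)) := by
        rw [← hχ', mul_assoc, mul_assoc, hjj, mul_neg, neg_neg]
      have e' : I (γ 0) * s' * j (γ 0) = -s' := by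
        rw [← hs'j, mul_assoc, hj, mul_neg_one]
      simp only [Pi.mul_apply, zero_smul, add_zero, add_mul, hL, hnabla, e, e', sub_mul]
      rw [hs'def]
      module

end Twisted

/-! ### The pointwise equivalence and the theorem. -/

section Main

variable {M : Type*} [TopologicalSpace M] [ChartedSpace (EuclideanSpace ℝ (Fin 2)) M]
  [IsManifold (𝓡 2) ∞ M] {o : SurfaceOrientation M} {f : M → ℍ} {V : M → Submodule ℝ ℍ}

/-- Both versions of `V₊` are fields of eigenspaces `{s | s j_L = I s}`, where `I` is `j_L` or
constant. -/
theorem IsVPlus.exists_eigenspace (hf : IsSmoothImmersion f) (hV : IsVPlus f o V) :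
    ∃ I : M → ℍ, (∀ y, I y * I y = -1) ∧ (∀ y s, s ∈ V y ↔ s * jL f o y = I y * s) ∧
      (I = jL f o ∨ ∃ i : ℍ, I = fun _ => i) := by
  rcases hV with hV | ⟨i, hi, hV⟩
  · refine ⟨jL f o, fun y => jL_mul_self (hf.2 y), fun y s => ?_, Or.inl rfl⟩
    rw [commute_iff_exists (jL_mul_self (hf.2 y)), hV y, Submodule.mem_span_pair]
    simp only [eq_comm]
  · refine ⟨fun _ => i, fun _ => hi, fun y s => ?_, Or.inr ⟨i, rfl⟩⟩
    rw [← spinorR_eq_mul, ← SetLike.mem_coe, hV y]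
    rfl

/-- As $d$ anticommutes with $j$, right multiplication by $d$ carries $V$ into $V^\perp$, and so
does left multiplication when $I=j$; right multiplication by $j$ preserves $V^\perp$. -/
theorem secondFundamentalForm_mem_orthogonal {I j χ d D : ℍ} {W : Submodule ℝ ℍ}
    (hI : I * I = -1) (hj : j * j = -1) (hW : ∀ s, s ∈ W ↔ s * j = I * s) (hχ : χ ∈ W)
    (hd : d * j = -(j * d)) (hD : (I = j ∧ D = d) ∨ D = 0) :
    (1 / 2 : ℝ) • ((χ * d - D * χ) * j) ∈ Wᗮ := by
  refine Submodule.smul_mem _ _ ((mem_orthogonal_eigenspace_iff hI hj hW _).2 ?_)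
  have hχ' := (hW χ).1 hχ
  rcases hD with ⟨rfl, rfl⟩ | rfl
  · have e : (χ * D - D * χ) * I = -(I * (χ * D - D * χ)) := by
      rw [sub_mul, mul_sub, mul_assoc, hd, mul_assoc, hχ', mul_neg, ← mul_assoc χ, hχ',
        ← mul_assoc D, hd]
      noncomm_ring
    rw [e, neg_mul, mul_assoc, e, mul_neg]
  · rw [zero_mul, sub_zero, mul_assoc χ, hd, mul_neg, ← mul_assoc χ, hχ', neg_mul, mul_assoc,
      hd, mul_assoc, mul_neg, ← hχ', mul_assoc]

/-- Quantifying over the whole fibre of $V$ at $x$ is what separates the single Cayley equation into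
its two parts. -/
theorem isCayleySubspace_twistedTangent_iff (hf : IsSmoothImmersion f) (hV : IsVPlus f o V)
    {ψ : M → ℍ} (hψ : IsSmoothSectionMinus V ψ) {x : M} {w : Fin 2 → TangentSpace (𝓡 2) x}
    (hw : IsOrientedFrame f o x w) :
    (∀ χ ∈ V x, IsCayleySubspace (twistedTangent f V ψ x χ)) ↔
      MeanCurvatureZero f x w ∧ nablaMinus V ψ x (w 0) = nablaMinus V ψ x (w 1) * jL f o x := by
  obtain ⟨I, hI, hVI, hIj⟩ := hV.exists_eigenspace hf
  have hj : ∀ y, jL f o y * jL f o y = -1 := fun y => jL_mul_self (hf.2 y)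
  have hjd := mdifferentiableAt_jL o hf x
  have hId : MDifferentiableAt (𝓡 2) 𝓘(ℝ, ℍ) I x := by
    rcases hIj with rfl | ⟨i, rfl⟩
    · exact hjd
    · exact mdifferentiableAt_const
  have hD : ∀ v, (I x = jL f o x ∧ dmap I x v = dmap (jL f o) x v) ∨ dmap I x v = 0 := by
    intro v
    rcases hIj with rfl | ⟨i, rfl⟩
    · exact Or.inl ⟨rfl, rfl⟩
    · right
      rw [dmap, mfderiv_const]
      rfl
  have hD' : (I x = jL f o x ∧ dmap I x (w 0) = dmap (jL f o) x (w 0) ∧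
      dmap I x (w 1) = dmap (jL f o) x (w 1)) ∨ (dmap I x (w 0) = 0 ∧ dmap I x (w 1) = 0) := by
    rcases hIj with rfl | ⟨i, rfl⟩
    · exact Or.inl ⟨rfl, rfl, rfl⟩
    · right
      rw [dmap, mfderiv_const]
      exact ⟨rfl, rfl⟩
  rw [← dmap_jL_eq_iff o hf hw, ← forall_secondFundamentalForm_iff (hI x) (hj x) (hVI x)
    (dmap_jL_mul o hf (w 0)) (dmap_jL_mul o hf (w 1)) hD']
  refine forall₂_congr fun χ hχ => ?_
  rw [twistedTangent_eq hI hj hVI hId hjd (hf.1.mdifferentiable (by simp) x)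
    (hψ.1.mdifferentiable (by simp) x) (dmap_jL_mul o hf)
    (exists_eq_smul_add_smul_of_orthonormal o hw.1) hχ]
  exact isCayleySubspace_graph_iff (hI x) (hj x) (hVI x) (hw.1.1 0) (hw.1.1 1)
    (jL_eq_star_mul o hw).symm
    (add_mem (secondFundamentalForm_mem_orthogonal (hI x) (hj x) (hVI x) hχ (dmap_jL_mul o hf _)
      (hD _)) (Submodule.starProjection_apply_mem _ _))
    (add_mem (secondFundamentalForm_mem_orthogonal (hI x) (hj x) (hVI x) hχ (dmap_jL_mul o hf _)
      (hD _)) (Submodule.starProjection_apply_mem _ _))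

end Main

end

theorem theorem3p4 {M : Type*} [TopologicalSpace M] [ChartedSpace (EuclideanSpace ℝ (Fin 2)) M]
    [IsManifold (𝓡 2) ∞ M] (o : SurfaceOrientation M)
    (f : M → ℍ) (hf : IsSmoothImmersion f)
    (V : M → Submodule ℝ ℍ) (hV : IsVPlus f o V)
    (ψ : M → ℍ) (hψ : IsSmoothSectionMinus V ψ) :
    IsCayleyTwisted f V ψ ↔ IsMinimalImmersion f ∧ IsHolomorphicSectionMinus f o V ψ := by
  rw [isMinimalImmersion_iff o hf]
  have hhol : ∀ (x : M) (w : Fin 2 → TangentSpace (𝓡 2) x),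
      nablaMinus V ψ x (w 0) + -spinorR f o x (nablaMinus V ψ x (w 1)) = 0 ↔
        nablaMinus V ψ x (w 0) = nablaMinus V ψ x (w 1) * jL f o x := fun x w => by
    rw [spinorR_eq_mul, add_neg_eq_zero]
  constructor
  · intro h
    have key := fun x (w : Fin 2 → TangentSpace (𝓡 2) x) (hw : IsOrientedFrame f o x w) =>
      (isCayleySubspace_twistedTangent_iff hf hV hψ hw).1 (h x)
    exact ⟨fun x w hw => (key x w hw).1, fun x w hw => (hhol x w).2 (key x w hw).2⟩
  · rintro ⟨h1, h2⟩ x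
    -- One oriented frame is enough here: the tangent spaces of $X_\psi$ do not depend on it.
    obtain ⟨w, hw⟩ := exists_isOrientedFrame o (hf.2 x)
    exact (isCayleySubspace_twistedTangent_iff hf hV hψ hw).2
      ⟨h1 x w hw, (hhol x w).1 (h2 x w hw)⟩
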